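/- Let $k$ be a field. Identify the category $\mathfrak{Qco}(\mathbf P^1(k))$ of quasi-coherent sheaves on the projective line with the category of diagrams $M\xrightarrow{\sigma}P\xleftarrow{\tau}N$, where $M$, $P$, $N$ are modules over $k[x]$, $k[x,x^{-1}]$, $k[x^{-1}]$ respectively, $\sigma$ is $k[x]$-linear and $\tau$ is $k[x^{-1}]$-linear, $\sigma$ exhibits $P$ as the localization of $M$ at $\{1,x,x^2,\dots\}$, and $\tau$ exhibits $P$ as the localization of $N$ at $\{1,x^{-1},x^{-2},\dots\}$. For $n\in\mathbb Z$ let $\mathcal O(n)$ be the diagram $k[x]\to k[x,x^{-1}]\leftarrow k[x^{-1}]$ whose first map is the inclusion and whose second map is $q\mapsto x^nq$, and put $\mathcal U=\{\mathcal O(n): n\in\mathbb Z\}$. In an abelian category write $\mathcal D^\perp$ for the class of objects $Y$ with $\mathrm{Ext}^1(D,Y)=0$ for all $D\in\mathcal D$, and ${}^\perp\mathcal D$ for the class of objects $Z$ with $\mathrm{Ext}^1(Z,D)=0$ for all $D\in\mathcal D$; here $\mathrm{Ext}^1(A,B)$ is the group of classes of short exact sequences $0\to B\to L\to A\to 0$.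 A pair $(\mathcal F,\mathcal C)$ of classes of objects is a cotorsion pair if $\mathcal F^\perp=\mathcal C$ and ${}^\perp\mathcal C=\mathcal F$. It is complete if, moreover, for every object $Z$ there are short exact sequences $0\to Z\to C\to F\to 0$ and $0\to C'\to F'\to Z\to 0$ with $F,F'\in\mathcal F$ and $C,C'\in\mathcal C$. It is cogenerated by a set $S$ if it equals $({}^\perp(S^\perp),S^\perp)$. A quasi-coherent sheaf $M\to P\leftarrow N$ is locally projective if $M$, $P$, $N$ are projective modules over $k[x]$, $k[x,x^{-1}]$, $k[x^{-1}]$. Let $\widetilde{\mathcal U^\perp}$ be the class of exact (unbounded cochain) complexes $E$ of quasi-coherent sheaves with $Z_nE=\ker(E^n\to E^{n+1})\in\mathcal U^\perp$ for all $n\in\mathbb Z$. Let $dg\widetilde{\mathcal P}$ be the class of dg-locally projective complexes, that is, complexes $M$ such that every term $M^n$ is locally projective and the complex of abelian groups $\mathrm{Hom}(M,E)$, with $\mathrm{Hom}(M,E)^n=\prod_{j\in\mathbb Z}\mathrm{Hom}(M^j,E^{j+n})$, is exact for every $E\in\widetilde{\mathcal U^\perp}$. For $n,m\in\mathbb Z$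 let $\underline{\mathcal O(n)}[m]$ be the complex with $\mathcal O(n)$ in degree $-m$ and $0$ in all other degrees. Then $(dg\widetilde{\mathcal P},\widetilde{\mathcal U^\perp})$ is a complete cotorsion pair in $\mathrm{Ch}(\mathfrak{Qco}(\mathbf P^1(k)))$, and it is cogenerated by the set $\{\underline{\mathcal O(n)}[m]: n,m\in\mathbb Z\}$. -/

import Mathlib

open CategoryTheory CategoryTheory.Limits
open scoped Polynomial LaurentPolynomial

universe u

namespace LocallyProjective

noncomputable section

section RestrictScalars

variable {A B : Type u} [CommRing A] [CommRing B] {φ : A →+* B}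

/-- A `φ`-semilinear map as a morphism of `A`-modules `M ⟶ φ^* P`. -/
def toRes (φ : A →+* B) {M : ModuleCat.{u} A} {P : ModuleCat.{u} B} (f : M →+ P)
    (h : ∀ (a : A) (m : M), f (a • m) = φ a • f m) :
    M ⟶ (ModuleCat.restrictScalars φ).obj P :=
  ModuleCat.ofHom (Y := (ModuleCat.restrictScalars φ).obj P)
    { toFun := f
      map_add' := f.map_add
      map_smul' := h }

/-- The underlying additive map of a morphism `M ⟶ φ^* P`. -/
def resFun {M : ModuleCat.{u} A} {P : ModuleCat.{u} B}
    (f : M ⟶ (ModuleCat.restrictScalars φ).obj P) : M →+ P :=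
  f.hom.toAddMonoidHom

@[simp] lemma resFun_toRes {M : ModuleCat.{u} A} {P : ModuleCat.{u} B} (f : M →+ P)
    (h : ∀ (a : A) (m : M), f (a • m) = φ a • f m) : resFun (toRes φ f h) = f := rfl

lemma resFun_smul {M : ModuleCat.{u} A} {P : ModuleCat.{u} B}
    (f : M ⟶ (ModuleCat.restrictScalars φ).obj P) (a : A) (m : M) :
    resFun f (a • m) = φ a • resFun f m :=
  f.hom.map_smul a m

lemma isLocalizedModule_iff {s : A} (hs : IsUnit (φ s)) {M : ModuleCat.{u} A}
    {P : ModuleCat.{u} B} (f : M ⟶ (ModuleCat.restrictScalars φ).obj P) :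
    IsLocalizedModule (Submonoid.powers s) f.hom ↔
      (∀ p : P, ∃ (n : ℕ) (m : M), φ s ^ n • p = resFun f m) ∧
      (∀ m : M, resFun f m = 0 → ∃ n : ℕ, s ^ n • m = 0) := by
  constructor
  · intro h
    refine ⟨fun p => ?_, fun m hm => ?_⟩
    · obtain ⟨⟨m, ⟨_, n, rfl⟩⟩, hx⟩ := h.surj p
      refine ⟨n, m, ?_⟩
      rw [← map_pow]
      exact hx
    · obtain ⟨⟨_, n, rfl⟩, hc⟩ := h.exists_of_eq (x₁ := m) (x₂ := 0)
        (by rw [map_zero]; exact hm)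
      refine ⟨n, ?_⟩
      have hc' : s ^ n • m = s ^ n • (0 : M) := hc
      rw [hc', smul_zero]
  · rintro ⟨h1, h2⟩
    refine ⟨?_, fun p => ?_, ?_⟩
    · rintro ⟨_, n, rfl⟩
      have hu : IsUnit (φ (s ^ n)) := by rw [map_pow]; exact hs.pow n
      rw [Module.End.isUnit_iff]
      constructor
      · intro x y hxy
        have hxy' : φ (s ^ n) • (show P from x) = φ (s ^ n) • (show P from y) := hxy
        exact (IsUnit.smul_left_cancel hu).1 hxy'
      · intro y
        refine ⟨((hu.unit⁻¹ : Bˣ) : B) • (show P from y), ?_⟩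
        change φ (s ^ n) • ((hu.unit⁻¹ : Bˣ) : B) • (show P from y) = y
        rw [smul_smul, IsUnit.mul_val_inv, one_smul]
    · obtain ⟨n, m, h⟩ := h1 p
      refine ⟨⟨m, ⟨_, n, rfl⟩⟩, ?_⟩
      change φ (s ^ n) • (show P from p) = resFun f m
      rw [map_pow]
      exact h
    · intro x y hxy
      obtain ⟨n, hn⟩ := h2 (x - y) (by
        rw [map_sub]; exact sub_eq_zero.2 hxy)
      refine ⟨⟨_, n, rfl⟩, ?_⟩
      change s ^ n • x = s ^ n • y
      rwa [smul_sub, sub_eq_zero] at hn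

end RestrictScalars

variable (k : Type u) [Field k]

/-- The inclusion `k[x] → k[x, x⁻¹]`. -/
def inclPos : k[X] →+* k[T;T⁻¹] := Polynomial.toLaurent

/-- The inclusion `k[x⁻¹] → k[x, x⁻¹]`, where the polynomial ring `k[x⁻¹]` is written `k[X]`, its
variable `X` being `x⁻¹`. -/
def inclNeg : k[X] →+* k[T;T⁻¹] :=
  (LaurentPolynomial.invert (R := k)).toRingHom.comp Polynomial.toLaurent

variable {k} in
lemma inclPos_X : inclPos k Polynomial.X = LaurentPolynomial.T 1 := by
  simp [inclPos]

variable {k} in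
lemma inclNeg_X : inclNeg k Polynomial.X = LaurentPolynomial.T (-1) := by
  simp [inclNeg]

lemma isUnit_inclPos : IsUnit (inclPos k Polynomial.X) := by
  rw [inclPos_X]; exact LaurentPolynomial.isUnit_T 1

lemma isUnit_inclNeg : IsUnit (inclNeg k Polynomial.X) := by
  rw [inclNeg_X]; exact LaurentPolynomial.isUnit_T (-1)

/-- A quasi-coherent sheaf on the projective line over `k`, as a diagram `M ⟶ P ⟵ N` with `M` a
`k[x]`-module, `P` a `k[x, x⁻¹]`-module and `N` a `k[x⁻¹]`-module, the arrows being linear over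
`k[x]` and over `k[x⁻¹]`, such that `M ⟶ P` is the localization of `M` at the powers of `x` and
`N ⟶ P` is the localization of `N` at the powers of `x⁻¹`. -/
structure QcoP1 where
  /-- the sections over `Spec k[x]` -/
  M : ModuleCat.{u} k[X]
  /-- the sections over `Spec k[x, x⁻¹]` -/
  P : ModuleCat.{u} k[T;T⁻¹]
  /-- the sections over `Spec k[x⁻¹]` -/
  N : ModuleCat.{u} k[X]
  /-- the restriction map `M ⟶ P` -/
  σ : M ⟶ (ModuleCat.restrictScalars (inclPos k)).obj P
  /-- the restriction map `N ⟶ P` -/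
  τ : N ⟶ (ModuleCat.restrictScalars (inclNeg k)).obj P
  isLocalizedModule_σ : IsLocalizedModule (Submonoid.powers (Polynomial.X : k[X])) σ.hom
  isLocalizedModule_τ : IsLocalizedModule (Submonoid.powers (Polynomial.X : k[X])) τ.hom

namespace QcoP1

variable {k}

/-- A morphism of quasi-coherent sheaves: linear maps on the three modules, compatible with the
restriction maps. -/
@[ext]
structure Hom (F G : QcoP1 k) where
  hM : F.M ⟶ G.M
  hP : F.P ⟶ G.P
  hN : F.N ⟶ G.N
  comm_σ : F.σ ≫ (ModuleCat.restrictScalars (inclPos k)).map hP = hM ≫ G.σ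
  comm_τ : F.τ ≫ (ModuleCat.restrictScalars (inclNeg k)).map hP = hN ≫ G.τ

instance : Category (QcoP1 k) where
  Hom := Hom
  id F := ⟨𝟙 _, 𝟙 _, 𝟙 _, by simp, by simp⟩
  comp f g := ⟨f.hM ≫ g.hM, f.hP ≫ g.hP, f.hN ≫ g.hN,
    by rw [Functor.map_comp, ← Category.assoc, f.comm_σ, Category.assoc, g.comm_σ, Category.assoc],
    by rw [Functor.map_comp, ← Category.assoc, f.comm_τ, Category.assoc, g.comm_τ, Category.assoc]⟩

variable {F G H : QcoP1 k}

@[ext] lemma hom_ext {f g : F ⟶ G} (h1 : f.hM = g.hM) (h2 : f.hP = g.hP) (h3 : f.hN = g.hN) :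
    f = g := Hom.ext h1 h2 h3

@[simp] lemma id_hM : Hom.hM (𝟙 F) = 𝟙 _ := rfl
@[simp] lemma id_hP : Hom.hP (𝟙 F) = 𝟙 _ := rfl
@[simp] lemma id_hN : Hom.hN (𝟙 F) = 𝟙 _ := rfl
@[simp] lemma comp_hM (f : F ⟶ G) (g : G ⟶ H) : (f ≫ g).hM = f.hM ≫ g.hM := rfl
@[simp] lemma comp_hP (f : F ⟶ G) (g : G ⟶ H) : (f ≫ g).hP = f.hP ≫ g.hP := rfl
@[simp] lemma comp_hN (f : F ⟶ G) (g : G ⟶ H) : (f ≫ g).hN = f.hN ≫ g.hN := rfl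

/-- The restriction map `M ⟶ P` as an additive map. -/
def s (F : QcoP1 k) : F.M →+ F.P := resFun F.σ
/-- The restriction map `N ⟶ P` as an additive map. -/
def t (F : QcoP1 k) : F.N →+ F.P := resFun F.τ

lemma s_smul (a : k[X]) (m : F.M) : F.s (a • m) = inclPos k a • F.s m := resFun_smul _ _ _
lemma t_smul (a : k[X]) (m : F.N) : F.t (a • m) = inclNeg k a • F.t m := resFun_smul _ _ _

lemma s_surj (p : F.P) : ∃ (n : ℕ) (m : F.M), inclPos k Polynomial.X ^ n • p = F.s m :=
  ((isLocalizedModule_iff (isUnit_inclPos k) _).1 F.isLocalizedModule_σ).1 p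
lemma s_inj (m : F.M) (h : F.s m = 0) : ∃ n : ℕ, (Polynomial.X : k[X]) ^ n • m = 0 :=
  ((isLocalizedModule_iff (isUnit_inclPos k) _).1 F.isLocalizedModule_σ).2 m h
lemma t_surj (p : F.P) : ∃ (n : ℕ) (m : F.N), inclNeg k Polynomial.X ^ n • p = F.t m :=
  ((isLocalizedModule_iff (isUnit_inclNeg k) _).1 F.isLocalizedModule_τ).1 p
lemma t_inj (m : F.N) (h : F.t m = 0) : ∃ n : ℕ, (Polynomial.X : k[X]) ^ n • m = 0 :=
  ((isLocalizedModule_iff (isUnit_inclNeg k) _).1 F.isLocalizedModule_τ).2 m h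

lemma hP_s (f : F ⟶ G) (m : F.M) : f.hP.hom (F.s m) = G.s (f.hM.hom m) :=
  congr($(f.comm_σ).hom m)
lemma hP_t (f : F ⟶ G) (m : F.N) : f.hP.hom (F.t m) = G.t (f.hN.hom m) :=
  congr($(f.comm_τ).hom m)

/-- Constructor from additive maps. -/
def mk' (M : ModuleCat.{u} k[X]) (P : ModuleCat.{u} k[T;T⁻¹]) (N : ModuleCat.{u} k[X])
    (s : M →+ P) (t : N →+ P)
    (hs : ∀ (a : k[X]) (m : M), s (a • m) = inclPos k a • s m)
    (ht : ∀ (a : k[X]) (m : N), t (a • m) = inclNeg k a • t m)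
    (s1 : ∀ p : P, ∃ (n : ℕ) (m : M), inclPos k Polynomial.X ^ n • p = s m)
    (s2 : ∀ m : M, s m = 0 → ∃ n : ℕ, (Polynomial.X : k[X]) ^ n • m = 0)
    (t1 : ∀ p : P, ∃ (n : ℕ) (m : N), inclNeg k Polynomial.X ^ n • p = t m)
    (t2 : ∀ m : N, t m = 0 → ∃ n : ℕ, (Polynomial.X : k[X]) ^ n • m = 0) : QcoP1 k where
  M := M
  P := P
  N := N
  σ := toRes _ s hs
  τ := toRes _ t ht
  isLocalizedModule_σ := (isLocalizedModule_iff (isUnit_inclPos k) _).2 ⟨s1, s2⟩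
  isLocalizedModule_τ := (isLocalizedModule_iff (isUnit_inclNeg k) _).2 ⟨t1, t2⟩

/-- Constructor for morphisms from linear maps. -/
def homMk (a : F.M →ₗ[k[X]] G.M) (b : F.P →ₗ[k[T;T⁻¹]] G.P) (c : F.N →ₗ[k[X]] G.N)
    (h1 : ∀ m, b (F.s m) = G.s (a m)) (h2 : ∀ m, b (F.t m) = G.t (c m)) : F ⟶ G where
  hM := ModuleCat.ofHom a
  hP := ModuleCat.ofHom b
  hN := ModuleCat.ofHom c
  comm_σ := by ext m; exact h1 m
  comm_τ := by ext m; exact h2 m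

section Preadditive

instance : Zero (F ⟶ G) := ⟨homMk 0 0 0 (fun _ => by simp) (fun _ => by simp)⟩
instance : Add (F ⟶ G) := ⟨fun f g => homMk (f.hM.hom + g.hM.hom) (f.hP.hom + g.hP.hom)
  (f.hN.hom + g.hN.hom) (fun m => by simp [hP_s]) (fun m => by simp [hP_t])⟩
instance : Neg (F ⟶ G) := ⟨fun f => homMk (-f.hM.hom) (-f.hP.hom) (-f.hN.hom)
  (fun m => by simp [hP_s]) (fun m => by simp [hP_t])⟩

@[simp] lemma zero_hM : Hom.hM (0 : F ⟶ G) = 0 := rfl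
@[simp] lemma zero_hP : Hom.hP (0 : F ⟶ G) = 0 := rfl
@[simp] lemma zero_hN : Hom.hN (0 : F ⟶ G) = 0 := rfl
@[simp] lemma add_hM (f g : F ⟶ G) : (f + g).hM = f.hM + g.hM := rfl
@[simp] lemma add_hP (f g : F ⟶ G) : (f + g).hP = f.hP + g.hP := rfl
@[simp] lemma add_hN (f g : F ⟶ G) : (f + g).hN = f.hN + g.hN := rfl
@[simp] lemma neg_hM (f : F ⟶ G) : (-f).hM = -f.hM := rfl
@[simp] lemma neg_hP (f : F ⟶ G) : (-f).hP = -f.hP := rfl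
@[simp] lemma neg_hN (f : F ⟶ G) : (-f).hN = -f.hN := rfl

instance : AddCommGroup (F ⟶ G) where
  add_assoc f g h := by ext1 <;> simp [add_assoc]
  zero_add f := by ext1 <;> simp
  add_zero f := by ext1 <;> simp
  neg_add_cancel f := by ext1 <;> simp
  add_comm f g := by ext1 <;> simp [add_comm]
  nsmul := nsmulRec
  zsmul := zsmulRec

instance : Preadditive (QcoP1 k) where
  add_comp _ _ _ f g h := by ext1 <;> simp
  comp_add _ _ _ f g h := by ext1 <;> simp

end Preadditive

section Kernels

/-- The kernel of a morphism, computed componentwise. -/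
def ker (f : F ⟶ G) : QcoP1 k :=
  mk' (ModuleCat.of _ (LinearMap.ker f.hM.hom)) (ModuleCat.of _ (LinearMap.ker f.hP.hom))
    (ModuleCat.of _ (LinearMap.ker f.hN.hom))
    { toFun := fun m => ⟨F.s m.1, by rw [LinearMap.mem_ker, hP_s, LinearMap.mem_ker.1 m.2, map_zero]⟩
      map_zero' := Subtype.ext (map_zero F.s)
      map_add' := fun x y => Subtype.ext (map_add F.s x.1 y.1) }
    { toFun := fun m => ⟨F.t m.1, by rw [LinearMap.mem_ker, hP_t, LinearMap.mem_ker.1 m.2, map_zero]⟩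
      map_zero' := Subtype.ext (map_zero F.t)
      map_add' := fun x y => Subtype.ext (map_add F.t x.1 y.1) }
    (fun a m => Subtype.ext (s_smul a m.1))
    (fun a m => Subtype.ext (t_smul a m.1))
    (fun p => by
      obtain ⟨n, m, h⟩ := F.s_surj p.1
      have h0 : G.s (f.hM.hom m) = 0 := by
        rw [← hP_s, ← h, map_smul, LinearMap.mem_ker.1 p.2, smul_zero]
      obtain ⟨n', h'⟩ := G.s_inj _ h0
      refine ⟨n' + n, ⟨(Polynomial.X : k[X]) ^ n' • m, ?_⟩, Subtype.ext ?_⟩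
      · rw [LinearMap.mem_ker, map_smul, h']
      · change inclPos k Polynomial.X ^ (n' + n) • p.1 = F.s ((Polynomial.X : k[X]) ^ n' • m)
        rw [s_smul, ← h, map_pow, smul_smul, pow_add])
    (fun m h => by
      obtain ⟨n, hn⟩ := F.s_inj m.1 (congrArg Subtype.val h)
      exact ⟨n, Subtype.ext hn⟩)
    (fun p => by
      obtain ⟨n, m, h⟩ := F.t_surj p.1
      have h0 : G.t (f.hN.hom m) = 0 := by
        rw [← hP_t, ← h, map_smul, LinearMap.mem_ker.1 p.2, smul_zero]
      obtain ⟨n', h'⟩ := G.t_inj _ h0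
      refine ⟨n' + n, ⟨(Polynomial.X : k[X]) ^ n' • m, ?_⟩, Subtype.ext ?_⟩
      · rw [LinearMap.mem_ker, map_smul, h']
      · change inclNeg k Polynomial.X ^ (n' + n) • p.1 = F.t ((Polynomial.X : k[X]) ^ n' • m)
        rw [t_smul, ← h, map_pow, smul_smul, pow_add])
    (fun m h => by
      obtain ⟨n, hn⟩ := F.t_inj m.1 (congrArg Subtype.val h)
      exact ⟨n, Subtype.ext hn⟩)

/-- The inclusion of the kernel. -/
def kerι (f : F ⟶ G) : ker f ⟶ F :=
  homMk (F := ker f) (LinearMap.ker f.hM.hom).subtype (LinearMap.ker f.hP.hom).subtype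
    (LinearMap.ker f.hN.hom).subtype (fun _ => rfl) (fun _ => rfl)

lemma kerι_comp (f : F ⟶ G) : kerι f ≫ f = 0 := by
  ext m
  · exact m.2
  · exact m.2
  · exact m.2

/-- The universal property of the kernel. -/
def kerLift (f : F ⟶ G) (g : H ⟶ F) (w : g ≫ f = 0) : H ⟶ ker f :=
  homMk (G := ker f)
    (LinearMap.codRestrict _ g.hM.hom fun m => congr($(congrArg Hom.hM w).hom m))
    (LinearMap.codRestrict _ g.hP.hom fun m => congr($(congrArg Hom.hP w).hom m))
    (LinearMap.codRestrict _ g.hN.hom fun m => congr($(congrArg Hom.hN w).hom m))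
    (fun m => Subtype.ext (hP_s g m)) (fun m => Subtype.ext (hP_t g m))

lemma kerLift_ι (f : F ⟶ G) (g : H ⟶ F) (w : g ≫ f = 0) : kerLift f g w ≫ kerι f = g := rfl

lemma mono_of_injective (f : F ⟶ G) (h1 : Function.Injective f.hM.hom)
    (h2 : Function.Injective f.hP.hom) (h3 : Function.Injective f.hN.hom) : Mono f := by
  refine ⟨fun {H} g g' h => ?_⟩
  ext m
  · exact h1 (congr($(congrArg Hom.hM h).hom m))
  · exact h2 (congr($(congrArg Hom.hP h).hom m))
  · exact h3 (congr($(congrArg Hom.hN h).hom m))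

instance (f : F ⟶ G) : Mono (kerι f) :=
  mono_of_injective _ Subtype.val_injective Subtype.val_injective Subtype.val_injective

lemma injective_of_mono (f : F ⟶ G) [Mono f] : Function.Injective f.hM.hom ∧
    Function.Injective f.hP.hom ∧ Function.Injective f.hN.hom := by
  have h : kerι f = 0 := by rw [← cancel_mono f, kerι_comp, zero_comp]
  refine ⟨?_, ?_, ?_⟩
  · exact (injective_iff_map_eq_zero _).2 fun m hm => congr($(congrArg Hom.hM h).hom ⟨m, hm⟩)
  · exact (injective_iff_map_eq_zero _).2 fun m hm => congr($(congrArg Hom.hP h).hom ⟨m, hm⟩)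
  · exact (injective_iff_map_eq_zero _).2 fun m hm => congr($(congrArg Hom.hN h).hom ⟨m, hm⟩)

instance : HasKernels (QcoP1 k) where
  has_limit f := ⟨⟨_, KernelFork.IsLimit.ofι' (kerι f) (kerι_comp f)
    (fun g w => ⟨kerLift f g w, kerLift_ι f g w⟩)⟩⟩

end Kernels

section Cokernels

/-- The map induced by `M ⟶ P` on cokernels. -/
def cokS (f : F ⟶ G) : (G.M ⧸ LinearMap.range f.hM.hom) →+ (G.P ⧸ LinearMap.range f.hP.hom) :=
  QuotientAddGroup.map _ (LinearMap.range f.hP.hom).toAddSubgroup G.s (by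
    rintro _ ⟨m, rfl⟩; exact ⟨F.s m, hP_s f m⟩)
/-- The map induced by `N ⟶ P` on cokernels. -/
def cokT (f : F ⟶ G) : (G.N ⧸ LinearMap.range f.hN.hom) →+ (G.P ⧸ LinearMap.range f.hP.hom) :=
  QuotientAddGroup.map _ (LinearMap.range f.hP.hom).toAddSubgroup G.t (by
    rintro _ ⟨m, rfl⟩; exact ⟨F.t m, hP_t f m⟩)

lemma cokS_mk (f : F ⟶ G) (m : G.M) :
    cokS f (Submodule.Quotient.mk m) = Submodule.Quotient.mk (G.s m) := rfl
lemma cokT_mk (f : F ⟶ G) (m : G.N) :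
    cokT f (Submodule.Quotient.mk m) = Submodule.Quotient.mk (G.t m) := rfl

/-- The cokernel of a morphism, computed componentwise. -/
def coker (f : F ⟶ G) : QcoP1 k :=
  mk' (ModuleCat.of _ (G.M ⧸ LinearMap.range f.hM.hom))
    (ModuleCat.of _ (G.P ⧸ LinearMap.range f.hP.hom))
    (ModuleCat.of _ (G.N ⧸ LinearMap.range f.hN.hom)) (cokS f) (cokT f)
    (fun a m => by
      obtain ⟨m, rfl⟩ := Submodule.Quotient.mk_surjective _ m
      rw [← Submodule.Quotient.mk_smul, cokS_mk, cokS_mk, s_smul, Submodule.Quotient.mk_smul])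
    (fun a m => by
      obtain ⟨m, rfl⟩ := Submodule.Quotient.mk_surjective _ m
      rw [← Submodule.Quotient.mk_smul, cokT_mk, cokT_mk, t_smul, Submodule.Quotient.mk_smul])
    (fun p => by
      obtain ⟨p, rfl⟩ := Submodule.Quotient.mk_surjective _ p
      obtain ⟨n, m, h⟩ := G.s_surj p
      exact ⟨n, Submodule.Quotient.mk m, by
        rw [cokS_mk, ← h, Submodule.Quotient.mk_smul]⟩)
    (fun m h => by
      obtain ⟨m, rfl⟩ := Submodule.Quotient.mk_surjective _ m
      rw [cokS_mk, Submodule.Quotient.mk_eq_zero] at h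
      obtain ⟨p, hp⟩ := h
      obtain ⟨n, q, hq⟩ := F.s_surj p
      have h0 : G.s ((Polynomial.X : k[X]) ^ n • m - f.hM.hom q) = 0 := by
        rw [map_sub, s_smul, ← hP_s, ← hq, map_smul, hp, map_pow, sub_self]
      obtain ⟨n', h'⟩ := G.s_inj _ h0
      refine ⟨n' + n, ?_⟩
      rw [← Submodule.Quotient.mk_smul, Submodule.Quotient.mk_eq_zero]
      refine ⟨(Polynomial.X : k[X]) ^ n' • q, ?_⟩
      rw [smul_sub, sub_eq_zero, smul_smul, ← pow_add] at h'
      rw [map_smul, h'])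
    (fun p => by
      obtain ⟨p, rfl⟩ := Submodule.Quotient.mk_surjective _ p
      obtain ⟨n, m, h⟩ := G.t_surj p
      exact ⟨n, Submodule.Quotient.mk m, by
        rw [cokT_mk, ← h, Submodule.Quotient.mk_smul]⟩)
    (fun m h => by
      obtain ⟨m, rfl⟩ := Submodule.Quotient.mk_surjective _ m
      rw [cokT_mk, Submodule.Quotient.mk_eq_zero] at h
      obtain ⟨p, hp⟩ := h
      obtain ⟨n, q, hq⟩ := F.t_surj p
      have h0 : G.t ((Polynomial.X : k[X]) ^ n • m - f.hN.hom q) = 0 := by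
        rw [map_sub, t_smul, ← hP_t, ← hq, map_smul, hp, map_pow, sub_self]
      obtain ⟨n', h'⟩ := G.t_inj _ h0
      refine ⟨n' + n, ?_⟩
      rw [← Submodule.Quotient.mk_smul, Submodule.Quotient.mk_eq_zero]
      refine ⟨(Polynomial.X : k[X]) ^ n' • q, ?_⟩
      rw [smul_sub, sub_eq_zero, smul_smul, ← pow_add] at h'
      rw [map_smul, h'])

/-- The projection to the cokernel. -/
def cokerπ (f : F ⟶ G) : G ⟶ coker f :=
  homMk (G := coker f) (LinearMap.range f.hM.hom).mkQ (LinearMap.range f.hP.hom).mkQ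
    (LinearMap.range f.hN.hom).mkQ (fun _ => rfl) (fun _ => rfl)

lemma comp_cokerπ (f : F ⟶ G) : f ≫ cokerπ f = 0 := by
  ext m
  · exact (Submodule.Quotient.mk_eq_zero _).2 ⟨m, rfl⟩
  · exact (Submodule.Quotient.mk_eq_zero _).2 ⟨m, rfl⟩
  · exact (Submodule.Quotient.mk_eq_zero _).2 ⟨m, rfl⟩

/-- The universal property of the cokernel. -/
def cokerDesc (f : F ⟶ G) (g : G ⟶ H) (w : f ≫ g = 0) : coker f ⟶ H :=
  homMk (F := coker f)
    (Submodule.liftQ _ g.hM.hom (by rintro _ ⟨m, rfl⟩; exact congr($(congrArg Hom.hM w).hom m)))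
    (Submodule.liftQ _ g.hP.hom (by rintro _ ⟨m, rfl⟩; exact congr($(congrArg Hom.hP w).hom m)))
    (Submodule.liftQ _ g.hN.hom (by rintro _ ⟨m, rfl⟩; exact congr($(congrArg Hom.hN w).hom m)))
    (fun m => by
      obtain ⟨m, rfl⟩ := Submodule.Quotient.mk_surjective _ m
      exact hP_s g m)
    (fun m => by
      obtain ⟨m, rfl⟩ := Submodule.Quotient.mk_surjective _ m
      exact hP_t g m)

lemma cokerπ_desc (f : F ⟶ G) (g : G ⟶ H) (w : f ≫ g = 0) : cokerπ f ≫ cokerDesc f g w = g := rfl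

lemma epi_of_surjective (f : F ⟶ G) (h1 : Function.Surjective f.hM.hom)
    (h2 : Function.Surjective f.hP.hom) (h3 : Function.Surjective f.hN.hom) : Epi f := by
  refine ⟨fun {H} g g' h => ?_⟩
  ext m
  · obtain ⟨m, rfl⟩ := h1 m
    exact congr($(congrArg Hom.hM h).hom m)
  · obtain ⟨m, rfl⟩ := h2 m
    exact congr($(congrArg Hom.hP h).hom m)
  · obtain ⟨m, rfl⟩ := h3 m
    exact congr($(congrArg Hom.hN h).hom m)

instance (f : F ⟶ G) : Epi (cokerπ f) :=
  epi_of_surjective _ (Submodule.Quotient.mk_surjective _) (Submodule.Quotient.mk_surjective _)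
    (Submodule.Quotient.mk_surjective _)

lemma surjective_of_epi (f : F ⟶ G) [Epi f] : Function.Surjective f.hM.hom ∧
    Function.Surjective f.hP.hom ∧ Function.Surjective f.hN.hom := by
  have h : cokerπ f = 0 := by rw [← cancel_epi f, comp_cokerπ, comp_zero]
  refine ⟨fun m => ?_, fun m => ?_, fun m => ?_⟩
  · exact (Submodule.Quotient.mk_eq_zero _).1 congr($(congrArg Hom.hM h).hom m)
  · exact (Submodule.Quotient.mk_eq_zero _).1 congr($(congrArg Hom.hP h).hom m)
  · exact (Submodule.Quotient.mk_eq_zero _).1 congr($(congrArg Hom.hN h).hom m)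

instance : HasCokernels (QcoP1 k) where
  has_colimit f := ⟨⟨_, CokernelCofork.IsColimit.ofπ' (cokerπ f) (comp_cokerπ f)
    (fun g w => ⟨cokerDesc f g w, cokerπ_desc f g w⟩)⟩⟩

end Cokernels

section Abelian

/-- Factorization through a monomorphism. -/
def monoLift (f : F ⟶ G) [Mono f] (g : H ⟶ G) (w : g ≫ cokerπ f = 0) : H ⟶ F :=
  have hM : ∀ m, g.hM.hom m ∈ LinearMap.range f.hM.hom := fun m =>
    (Submodule.Quotient.mk_eq_zero _).1 congr($(congrArg Hom.hM w).hom m)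
  have hP : ∀ m, g.hP.hom m ∈ LinearMap.range f.hP.hom := fun m =>
    (Submodule.Quotient.mk_eq_zero _).1 congr($(congrArg Hom.hP w).hom m)
  have hN : ∀ m, g.hN.hom m ∈ LinearMap.range f.hN.hom := fun m =>
    (Submodule.Quotient.mk_eq_zero _).1 congr($(congrArg Hom.hN w).hom m)
  have hf := injective_of_mono f
  homMk
    ((LinearEquiv.ofInjective f.hM.hom hf.1).symm.toLinearMap.comp
      (LinearMap.codRestrict _ g.hM.hom hM))
    ((LinearEquiv.ofInjective f.hP.hom hf.2.1).symm.toLinearMap.comp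
      (LinearMap.codRestrict _ g.hP.hom hP))
    ((LinearEquiv.ofInjective f.hN.hom hf.2.2).symm.toLinearMap.comp
      (LinearMap.codRestrict _ g.hN.hom hN))
    (fun m => hf.2.1 (by
      rw [hP_s]
      have e1 := congrArg Subtype.val ((LinearEquiv.ofInjective f.hP.hom hf.2.1).apply_symm_apply
        ⟨g.hP.hom (H.s m), hP _⟩)
      have e2 := congrArg Subtype.val ((LinearEquiv.ofInjective f.hM.hom hf.1).apply_symm_apply
        ⟨g.hM.hom m, hM _⟩)
      exact e1.trans ((hP_s g m).trans (congrArg G.s e2.symm))))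
    (fun m => hf.2.1 (by
      rw [hP_t]
      have e1 := congrArg Subtype.val ((LinearEquiv.ofInjective f.hP.hom hf.2.1).apply_symm_apply
        ⟨g.hP.hom (H.t m), hP _⟩)
      have e2 := congrArg Subtype.val ((LinearEquiv.ofInjective f.hN.hom hf.2.2).apply_symm_apply
        ⟨g.hN.hom m, hN _⟩)
      exact e1.trans ((hP_t g m).trans (congrArg G.t e2.symm))))

lemma monoLift_comp (f : F ⟶ G) [Mono f] (g : H ⟶ G) (w : g ≫ cokerπ f = 0) :
    monoLift f g w ≫ f = g := by
  have hf := injective_of_mono f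
  ext m
  · exact congrArg Subtype.val ((LinearEquiv.ofInjective f.hM.hom hf.1).apply_symm_apply
      ⟨g.hM.hom m, _⟩)
  · exact congrArg Subtype.val ((LinearEquiv.ofInjective f.hP.hom hf.2.1).apply_symm_apply
      ⟨g.hP.hom m, _⟩)
  · exact congrArg Subtype.val ((LinearEquiv.ofInjective f.hN.hom hf.2.2).apply_symm_apply
      ⟨g.hN.hom m, _⟩)

lemma exists_epiDesc (f : F ⟶ G) [Epi f] (g : F ⟶ H) (w : kerι f ≫ g = 0) :
    ∃ h : G ⟶ H, f ≫ h = g := by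
  obtain ⟨h1, h2, h3⟩ := surjective_of_epi f
  have w1 : LinearMap.ker f.hM.hom ≤ LinearMap.ker g.hM.hom := fun m hm =>
    congr($(congrArg Hom.hM w).hom ⟨m, hm⟩)
  have w2 : LinearMap.ker f.hP.hom ≤ LinearMap.ker g.hP.hom := fun m hm =>
    congr($(congrArg Hom.hP w).hom ⟨m, hm⟩)
  have w3 : LinearMap.ker f.hN.hom ≤ LinearMap.ker g.hN.hom := fun m hm =>
    congr($(congrArg Hom.hN w).hom ⟨m, hm⟩)
  let a := (Submodule.liftQ _ g.hM.hom w1).comp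
    (f.hM.hom.quotKerEquivOfSurjective h1).symm.toLinearMap
  let b := (Submodule.liftQ _ g.hP.hom w2).comp
    (f.hP.hom.quotKerEquivOfSurjective h2).symm.toLinearMap
  let c := (Submodule.liftQ _ g.hN.hom w3).comp
    (f.hN.hom.quotKerEquivOfSurjective h3).symm.toLinearMap
  have ha : ∀ m, a (f.hM.hom m) = g.hM.hom m := fun m => by
    have := (f.hM.hom.quotKerEquivOfSurjective h1).symm_apply_apply (Submodule.Quotient.mk m)
    exact congrArg (Submodule.liftQ _ g.hM.hom w1) this
  have hb : ∀ m, b (f.hP.hom m) = g.hP.hom m := fun m => by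
    have := (f.hP.hom.quotKerEquivOfSurjective h2).symm_apply_apply (Submodule.Quotient.mk m)
    exact congrArg (Submodule.liftQ _ g.hP.hom w2) this
  have hc : ∀ m, c (f.hN.hom m) = g.hN.hom m := fun m => by
    have := (f.hN.hom.quotKerEquivOfSurjective h3).symm_apply_apply (Submodule.Quotient.mk m)
    exact congrArg (Submodule.liftQ _ g.hN.hom w3) this
  refine ⟨homMk a b c (fun m => ?_) (fun m => ?_), ?_⟩
  · obtain ⟨m, rfl⟩ := h1 m
    rw [ha, ← hP_s, hb, hP_s]
  · obtain ⟨m, rfl⟩ := h3 m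
    rw [hc, ← hP_t, hb, hP_t]
  · ext m
    · exact ha m
    · exact hb m
    · exact hc m

instance : IsNormalMonoCategory (QcoP1 k) where
  normalMonoOfMono f _ := ⟨⟨_, cokerπ f, comp_cokerπ f, KernelFork.IsLimit.ofι' _ _
    (fun g w => ⟨monoLift f g w, monoLift_comp f g w⟩)⟩⟩

instance : IsNormalEpiCategory (QcoP1 k) where
  normalEpiOfEpi f _ := ⟨⟨_, kerι f, kerι_comp f, CokernelCofork.IsColimit.ofπ' _ _
    (fun g w => ⟨(exists_epiDesc f g w).choose, (exists_epiDesc f g w).choose_spec⟩)⟩⟩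

/-- The zero sheaf. -/
def zeroObj : QcoP1 k :=
  mk' (ModuleCat.of _ PUnit) (ModuleCat.of _ PUnit) (ModuleCat.of _ PUnit) 0 0
    (fun _ _ => rfl) (fun _ _ => rfl) (fun _ => ⟨0, 0, rfl⟩) (fun _ _ => ⟨0, rfl⟩)
    (fun _ => ⟨0, 0, rfl⟩) (fun _ _ => ⟨0, rfl⟩)

instance : HasZeroObject (QcoP1 k) :=
  ⟨zeroObj, (IsZero.iff_id_eq_zero _).2 (by ext m <;> rfl)⟩

/-- The direct sum of two sheaves, computed componentwise. -/
def prod (F G : QcoP1 k) : QcoP1 k :=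
  mk' (ModuleCat.of _ (F.M × G.M)) (ModuleCat.of _ (F.P × G.P)) (ModuleCat.of _ (F.N × G.N))
    (AddMonoidHom.prodMap F.s G.s) (AddMonoidHom.prodMap F.t G.t)
    (fun a m => Prod.ext (s_smul a m.1) (s_smul a m.2))
    (fun a m => Prod.ext (t_smul a m.1) (t_smul a m.2))
    (fun p => by
      obtain ⟨n, m, h⟩ := F.s_surj p.1
      obtain ⟨n', m', h'⟩ := G.s_surj p.2
      refine ⟨n + n', ((Polynomial.X : k[X]) ^ n' • m, (Polynomial.X : k[X]) ^ n • m'),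
        Prod.ext ?_ ?_⟩
      · change inclPos k Polynomial.X ^ (n + n') • p.1 = F.s ((Polynomial.X : k[X]) ^ n' • m)
        rw [s_smul, ← h, map_pow, smul_smul, add_comm, pow_add]
      · change inclPos k Polynomial.X ^ (n + n') • p.2 = G.s ((Polynomial.X : k[X]) ^ n • m')
        rw [s_smul, ← h', map_pow, smul_smul, pow_add])
    (fun m h => by
      obtain ⟨n, hn⟩ := F.s_inj m.1 (congrArg Prod.fst h)
      obtain ⟨n', hn'⟩ := G.s_inj m.2 (congrArg Prod.snd h)
      refine ⟨n + n', Prod.ext ?_ ?_⟩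
      · change (Polynomial.X : k[X]) ^ (n + n') • m.1 = 0
        rw [add_comm, pow_add, mul_smul, hn, smul_zero]
      · change (Polynomial.X : k[X]) ^ (n + n') • m.2 = 0
        rw [pow_add, mul_smul, hn', smul_zero])
    (fun p => by
      obtain ⟨n, m, h⟩ := F.t_surj p.1
      obtain ⟨n', m', h'⟩ := G.t_surj p.2
      refine ⟨n + n', ((Polynomial.X : k[X]) ^ n' • m, (Polynomial.X : k[X]) ^ n • m'),
        Prod.ext ?_ ?_⟩
      · change inclNeg k Polynomial.X ^ (n + n') • p.1 = F.t ((Polynomial.X : k[X]) ^ n' • m)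
        rw [t_smul, ← h, map_pow, smul_smul, add_comm, pow_add]
      · change inclNeg k Polynomial.X ^ (n + n') • p.2 = G.t ((Polynomial.X : k[X]) ^ n • m')
        rw [t_smul, ← h', map_pow, smul_smul, pow_add])
    (fun m h => by
      obtain ⟨n, hn⟩ := F.t_inj m.1 (congrArg Prod.fst h)
      obtain ⟨n', hn'⟩ := G.t_inj m.2 (congrArg Prod.snd h)
      refine ⟨n + n', Prod.ext ?_ ?_⟩
      · change (Polynomial.X : k[X]) ^ (n + n') • m.1 = 0
        rw [add_comm, pow_add, mul_smul, hn, smul_zero]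
      · change (Polynomial.X : k[X]) ^ (n + n') • m.2 = 0
        rw [pow_add, mul_smul, hn', smul_zero])

instance : HasBinaryProducts (QcoP1 k) :=
  have (F G : QcoP1 k) : HasLimit (pair F G) := ⟨⟨_, BinaryFan.isLimitMk
    (W := prod F G)
    (fst := homMk (F := prod F G) (LinearMap.fst _ _ _) (LinearMap.fst _ _ _) (LinearMap.fst _ _ _)
      (fun _ => rfl) (fun _ => rfl))
    (snd := homMk (F := prod F G) (LinearMap.snd _ _ _) (LinearMap.snd _ _ _) (LinearMap.snd _ _ _)
      (fun _ => rfl) (fun _ => rfl))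
    (fun s => homMk (G := prod F G) (LinearMap.prod (Hom.hM s.fst).hom (Hom.hM s.snd).hom)
      (LinearMap.prod (Hom.hP s.fst).hom (Hom.hP s.snd).hom)
      (LinearMap.prod (Hom.hN s.fst).hom (Hom.hN s.snd).hom)
      (fun m => Prod.ext (hP_s s.fst m) (hP_s s.snd m))
      (fun m => Prod.ext (hP_t s.fst m) (hP_t s.snd m)))
    (fun _ => rfl) (fun _ => rfl)
    (fun s m h1 h2 => by
      ext x
      · exact Prod.ext congr($(congrArg Hom.hM h1).hom x) congr($(congrArg Hom.hM h2).hom x)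
      · exact Prod.ext congr($(congrArg Hom.hP h1).hom x) congr($(congrArg Hom.hP h2).hom x)
      · exact Prod.ext congr($(congrArg Hom.hN h1).hom x) congr($(congrArg Hom.hN h2).hom x))⟩⟩
  hasBinaryProducts_of_hasLimit_pair _

instance : Abelian (QcoP1 k) where
  has_finite_products := hasFiniteProducts_of_has_binary_and_terminal

end Abelian

end QcoP1

/-- The sheaf `𝒪(n)`: the diagram `k[x] ⟶ k[x, x⁻¹] ⟵ k[x⁻¹]` whose first map is the inclusion and
whose second map is the inclusion followed by multiplication by `x ^ n`. -/
def twist (n : ℤ) : QcoP1 k :=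
  QcoP1.mk' (ModuleCat.of _ k[X]) (ModuleCat.of _ k[T;T⁻¹]) (ModuleCat.of _ k[X])
    (inclPos k).toAddMonoidHom
    ((AddMonoidHom.mulLeft (LaurentPolynomial.T n)).comp (inclNeg k).toAddMonoidHom)
    (fun a m => map_mul (inclPos k) a m)
    (fun a m => by
      change LaurentPolynomial.T n * inclNeg k (a * m) =
        inclNeg k a * (LaurentPolynomial.T n * inclNeg k m)
      rw [map_mul, mul_left_comm])
    (fun p => by
      obtain ⟨N, q, hq⟩ := LaurentPolynomial.exists_T_pow p
      refine ⟨N, q, ?_⟩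
      change inclPos k Polynomial.X ^ N * p = Polynomial.toLaurent q
      rw [hq, inclPos_X, LaurentPolynomial.T_pow, mul_one, mul_comm])
    (fun m h => ⟨0, by
      have h0 : m = 0 := Polynomial.toLaurent_injective (h.trans (map_zero _).symm)
      rw [h0, smul_zero]⟩)
    (fun p => by
      obtain ⟨N, q, hq⟩ := LaurentPolynomial.exists_T_pow
        (LaurentPolynomial.invert (LaurentPolynomial.T (-n) * p))
      refine ⟨N, q, ?_⟩
      change inclNeg k Polynomial.X ^ N * p =
        LaurentPolynomial.T n * LaurentPolynomial.invert (Polynomial.toLaurent q)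
      rw [hq, inclNeg_X, LaurentPolynomial.T_pow, map_mul, LaurentPolynomial.invert_T,
        LaurentPolynomial.involutive_invert, ← mul_assoc, ← mul_assoc, ← LaurentPolynomial.T_add,
        add_neg_cancel, LaurentPolynomial.T_zero, one_mul, mul_comm, mul_neg_one])
    (fun m h => ⟨0, by
      have h1 : LaurentPolynomial.T n * inclNeg k m = 0 := h
      have h2 : inclNeg k m = 0 := by
        rwa [(LaurentPolynomial.isUnit_T n).mul_right_eq_zero] at h1
      have h3 : Polynomial.toLaurent m = (0 : k[T;T⁻¹]) :=
        (LaurentPolynomial.invert (R := k)).injective (h2.trans (map_zero _).symm)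
      have h0 : m = 0 := Polynomial.toLaurent_injective (h3.trans (map_zero _).symm)
      rw [h0, smul_zero]⟩)

section Cotorsion

variable {A : Type*} [Category* A] [Abelian A]

/-- `Ext¹(X, Y) = 0`: every short exact sequence `0 ⟶ Y ⟶ L ⟶ X ⟶ 0` splits, that is, there is
only one class of extensions of `X` by `Y`. -/
def ExtOneVanishes (X Y : A) : Prop :=
  ∀ (L : A) (i : Y ⟶ L) (p : L ⟶ X) (w : i ≫ p = 0),
    (ShortComplex.mk i p w).ShortExact → Nonempty (ShortComplex.mk i p w).Splitting

/-- The class `𝒟^⊥` of the objects `Y` with `Ext¹(D, Y) = 0` for all `D` in `𝒟`. -/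
def rightPerp (𝒟 : ObjectProperty A) : ObjectProperty A :=
  fun Y => ∀ D : A, 𝒟 D → ExtOneVanishes D Y

/-- The class `^⊥𝒟` of the objects `Z` with `Ext¹(Z, D) = 0` for all `D` in `𝒟`. -/
def leftPerp (𝒟 : ObjectProperty A) : ObjectProperty A :=
  fun Z => ∀ D : A, 𝒟 D → ExtOneVanishes Z D

/-- `(ℱ, 𝒞)` is a cotorsion pair. -/
structure IsCotorsionPair (ℱ 𝒞 : ObjectProperty A) : Prop where
  rightPerp_eq : rightPerp ℱ = 𝒞
  leftPerp_eq : leftPerp 𝒞 = ℱ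

/-- Enough injectives: every `Z` has a short exact sequence `0 ⟶ Z ⟶ C ⟶ F ⟶ 0` with `F` in `ℱ`
and `C` in `𝒞`. -/
def HasEnoughInjectives (ℱ 𝒞 : ObjectProperty A) : Prop :=
  ∀ Z : A, ∃ (C F : A) (i : Z ⟶ C) (p : C ⟶ F) (w : i ≫ p = 0),
    ℱ F ∧ 𝒞 C ∧ (ShortComplex.mk i p w).ShortExact

/-- Enough projectives: every `Z` has a short exact sequence `0 ⟶ C ⟶ F ⟶ Z ⟶ 0` with `F` in `ℱ`
and `C` in `𝒞`. -/
def HasEnoughProjectives (ℱ 𝒞 : ObjectProperty A) : Prop :=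
  ∀ Z : A, ∃ (C F : A) (i : C ⟶ F) (p : F ⟶ Z) (w : i ≫ p = 0),
    ℱ F ∧ 𝒞 C ∧ (ShortComplex.mk i p w).ShortExact

/-- `(ℱ, 𝒞)` is a complete cotorsion pair. -/
structure IsCompleteCotorsionPair (ℱ 𝒞 : ObjectProperty A) : Prop
    extends IsCotorsionPair ℱ 𝒞 where
  hasEnoughInjectives : HasEnoughInjectives ℱ 𝒞
  hasEnoughProjectives : HasEnoughProjectives ℱ 𝒞

/-- The pair `(ℱ, 𝒞)` is cogenerated by the family `S`: it is the pair `(^⊥(S^⊥), S^⊥)`. -/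
def IsCogeneratedBy {ι : Type*} (ℱ 𝒞 : ObjectProperty A) (S : ι → A) : Prop :=
  ℱ = leftPerp (rightPerp (ObjectProperty.ofObj S)) ∧ 𝒞 = rightPerp (ObjectProperty.ofObj S)

end Cotorsion

/-- The class `𝒰 = {𝒪(n) : n ∈ ℤ}`. -/
def twists : ObjectProperty (QcoP1 k) := ObjectProperty.ofObj (twist k)

/-- Locally projective quasi-coherent sheaves: the three modules are projective over `k[x]`,
`k[x, x⁻¹]` and `k[x⁻¹]`. -/
def locallyProjective : ObjectProperty (QcoP1 k) := fun F =>
  Module.Projective k[X] F.M ∧ Module.Projective k[T;T⁻¹] F.P ∧ Module.Projective k[X] F.N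

/-- The class of exact complexes all of whose cycle objects lie in `𝒰^⊥`. -/
def exactWithCyclesInPerp : ObjectProperty (CochainComplex (QcoP1 k) ℤ) := fun E =>
  E.Acyclic ∧ ∀ n : ℤ, rightPerp (twists k) (E.cycles n)

/-- The class of dg-locally projective complexes: the complexes `M` with locally projective terms
such that the complex of abelian groups `Hom(M, E)` is exact for every exact complex `E` with cycles
in `𝒰^⊥`. -/
def dgLocallyProjective : ObjectProperty (CochainComplex (QcoP1 k) ℤ) := fun M =>
  (∀ n : ℤ, locallyProjective k (M.X n)) ∧
    ∀ E : CochainComplex (QcoP1 k) ℤ, exactWithCyclesInPerp k E →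
      (CochainComplex.HomComplex M E).Acyclic

/-- The stalk complex `𝒪(n)[m]`, with `𝒪(n)` in degree `-m` and zero elsewhere. -/
def stalkTwist (i : ℤ × ℤ) : CochainComplex (QcoP1 k) ℤ :=
  (HomologicalComplex.single (QcoP1 k) (ComplexShape.up ℤ) (-i.2)).obj (twist k i.1)

end

end LocallyProjective

/-! The pair turns out to be (complexes with locally projective terms, exact complexes with cycles
in `𝒰^⊥`): the `Hom` condition defining `dgLocallyProjective` holds automatically once the terms are
locally projective (`dgLocallyProjective_eq`).

On sheaves, `𝒰^⊥` consists of the `F` all of whose twists have vanishing first Čech cohomology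
(`rightPerp_twists_iff`). Since `H¹` is a cokernel, this class is closed under quotients as well as
extensions, so for an exact complex it makes no difference whether it is imposed on cycles or on
terms. Dually, `k[x]` is a principal ideal domain, so subsheaves of locally projective sheaves are
locally projective; hence cycles and boundaries of a complex with locally projective terms are again
locally projective.

The core is `extOneVanishes_of_locallyProjective`: a locally projective `F` of any rank has no
extensions by `G` in `𝒰^⊥`. Over the intersection, `F` is a free module with two bases `b`, `c`, one
from each chart. The basis `b` is well-ordered so that below each index all but finitely many
indices form a set stable under passing from `b` to `c` and back. The leading coordinates at `b i`
of elements of the `k[x⁻¹]`-lattice spanned by `c` then have bounded degree and form a rank one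
lattice `x ^ e k[x⁻¹]`. In effect `F` is filtered with quotients `𝒪(e)`, and the gluing cocycle of
an extension is killed by well-founded recursion along this filtration
(`exists_linearMap_of_bases`).

For complexes, the vanishing of `Ext¹(M, E)` reduces to `M` with zero differential, because `M` is
an extension of its boundaries by its cycles; there, degreewise sections are corrected one degree at
a time.

For completeness, `hull` embeds any sheaf into one in `𝒰^⊥`, with a splitting on each chart, so that
the cokernel is locally projective when the sheaf is. Contractible complexes on hulls embed
complexes of sheaves, contractible complexes on sums of twists cover them, and a pushout and a
pullback produce the two approximation sequences. Cogeneration by the stalks `𝒪(n)[m]` holds because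
the `𝒪(n)` generate: orthogonality to the stalks forces exactness, and then cycles in `𝒰^⊥`. -/

namespace LocallyProjective

noncomputable section

/-! ### Splitting of extensions in an abelian category -/

section Cotorsion

variable {A : Type*} [Category* A] [Abelian A]

/-- The pullback of a short exact sequence `0 ⟶ K ⟶ B ⟶ C ⟶ 0` along `X ⟶ C`. -/
lemma shortExact_pullback {K B C X : A} {i : K ⟶ B} {p : B ⟶ C} {w : i ≫ p = 0}
    (h : (ShortComplex.mk i p w).ShortExact) (f : X ⟶ C) :
    (ShortComplex.mk (pullback.lift i 0 (by rw [w, zero_comp]) : K ⟶ pullback p f) (pullback.snd p f)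
      (pullback.lift_snd _ _ _)).ShortExact := by
  have : Mono i := h.mono_f
  have : Epi p := h.epi_g
  have hm : Mono (pullback.lift i 0 (by rw [w, zero_comp]) : K ⟶ pullback p f) := by
    have : Mono ((pullback.lift i 0 (by rw [w, zero_comp]) : K ⟶ pullback p f) ≫ pullback.fst p f) := by
      rw [pullback.lift_fst]; infer_instance
    exact mono_of_mono _ (pullback.fst p f)
  refine ⟨ShortComplex.exact_of_f_is_kernel _ (KernelFork.IsLimit.ofι' _ _ fun {W} k hk => ?_)⟩
  have hk' : k ≫ pullback.snd p f = 0 := hk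
  have e : (k ≫ pullback.fst p f) ≫ p = 0 := by
    rw [Category.assoc, pullback.condition, reassoc_of% hk', zero_comp]
  refine ⟨h.exact.lift _ e, ?_⟩
  have e2 : h.exact.lift _ e ≫ i = k ≫ pullback.fst p f := h.exact.lift_f _ e
  apply pullback.hom_ext
  · rw [Category.assoc]
    exact (congrArg _ (pullback.lift_fst _ _ _)).trans e2
  · rw [Category.assoc, hk']
    exact (congrArg _ (pullback.lift_snd _ _ _)).trans comp_zero

/-- The pushout of a short exact sequence `0 ⟶ K ⟶ B ⟶ C ⟶ 0` along `K ⟶ Y`. -/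
lemma shortExact_pushout {K B C Y : A} {i : K ⟶ B} {p : B ⟶ C} {w : i ≫ p = 0}
    (h : (ShortComplex.mk i p w).ShortExact) (f : K ⟶ Y) :
    (ShortComplex.mk (pushout.inr i f) (pushout.desc p 0 (by rw [w, comp_zero]) : pushout i f ⟶ C)
      (pushout.inr_desc _ _ _)).ShortExact := by
  have : Mono i := h.mono_f
  have : Epi p := h.epi_g
  have hm : Epi (pushout.desc p 0 (by rw [w, comp_zero]) : pushout i f ⟶ C) := by
    have : Epi (pushout.inl i f ≫ (pushout.desc p 0 (by rw [w, comp_zero]) : pushout i f ⟶ C)) := by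
      rw [pushout.inl_desc]; infer_instance
    exact epi_of_epi (pushout.inl i f) _
  refine ⟨ShortComplex.exact_of_g_is_cokernel _ (CokernelCofork.IsColimit.ofπ' _ _
    fun {W} k hk => ?_)⟩
  have hk' : pushout.inr i f ≫ k = 0 := hk
  have e : i ≫ pushout.inl i f ≫ k = 0 := by
    rw [← Category.assoc, pushout.condition, Category.assoc, hk', comp_zero]
  refine ⟨h.exact.desc _ e, ?_⟩
  have e2 : p ≫ h.exact.desc _ e = pushout.inl i f ≫ k := h.exact.g_desc _ e
  apply pushout.hom_ext
  · rw [← Category.assoc]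
    exact (congrArg (· ≫ _) (pushout.inl_desc _ _ _)).trans e2
  · rw [← Category.assoc, hk']
    exact (congrArg (· ≫ _) (pushout.inr_desc _ _ _)).trans zero_comp

lemma shortExact_cokernel {K B : A} (i : K ⟶ B) [Mono i] :
    (ShortComplex.mk i (cokernel.π i) (cokernel.condition i)).ShortExact :=
  ⟨ShortComplex.exact_cokernel i⟩

lemma shortExact_kernel {B C : A} (p : B ⟶ C) [Epi p] :
    (ShortComplex.mk (kernel.ι p) p (kernel.condition p)).ShortExact :=
  ⟨ShortComplex.exact_kernel p⟩

namespace ExtOneVanishes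

lemma of_retraction {X Y : A} (H : ∀ (L : A) (i : Y ⟶ L) (p : L ⟶ X) (w : i ≫ p = 0),
    (ShortComplex.mk i p w).ShortExact → ∃ r : L ⟶ Y, i ≫ r = 𝟙 Y) : ExtOneVanishes X Y := by
  intro L i p w h
  obtain ⟨r, hr⟩ := H L i p w h
  exact ⟨ShortComplex.Splitting.ofExactOfRetraction _ h.exact r hr h.epi_g⟩

lemma of_section {X Y : A} (H : ∀ (L : A) (i : Y ⟶ L) (p : L ⟶ X) (w : i ≫ p = 0),
    (ShortComplex.mk i p w).ShortExact → ∃ s : X ⟶ L, s ≫ p = 𝟙 X) : ExtOneVanishes X Y := by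
  intro L i p w h
  obtain ⟨s, hs⟩ := H L i p w h
  exact ⟨ShortComplex.Splitting.ofExactOfSection _ h.exact s hs h.mono_f⟩

variable {X Y : A} (H : ExtOneVanishes X Y)
include H

lemma exists_retraction {L : A} {i : Y ⟶ L} {p : L ⟶ X} {w : i ≫ p = 0}
    (h : (ShortComplex.mk i p w).ShortExact) : ∃ r : L ⟶ Y, i ≫ r = 𝟙 Y := by
  obtain ⟨s⟩ := H L i p w h
  exact ⟨s.r, s.f_r⟩

lemma exists_section {L : A} {i : Y ⟶ L} {p : L ⟶ X} {w : i ≫ p = 0}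
    (h : (ShortComplex.mk i p w).ShortExact) : ∃ s : X ⟶ L, s ≫ p = 𝟙 X := by
  obtain ⟨s⟩ := H L i p w h
  exact ⟨s.s, s.s_g⟩

/-- If `Ext¹(X, Y) = 0`, then morphisms from `X` lift along epimorphisms with kernel `Y`. -/
lemma exists_lift {E Q : A} {i : Y ⟶ E} {p : E ⟶ Q} {w : i ≫ p = 0}
    (h : (ShortComplex.mk i p w).ShortExact) (f : X ⟶ Q) : ∃ g : X ⟶ E, g ≫ p = f := by
  obtain ⟨s, hs⟩ := H.exists_section (shortExact_pullback h f)
  exact ⟨s ≫ pullback.fst p f, by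
    rw [Category.assoc, pullback.condition, reassoc_of% hs]⟩

/-- If `Ext¹(X, Y) = 0`, then morphisms to `Y` extend along monomorphisms with cokernel `X`. -/
lemma exists_extension {K E : A} {i : K ⟶ E} {p : E ⟶ X} {w : i ≫ p = 0}
    (h : (ShortComplex.mk i p w).ShortExact) (f : K ⟶ Y) : ∃ g : E ⟶ Y, i ≫ g = f := by
  obtain ⟨r, hr⟩ := H.exists_retraction (shortExact_pushout h f)
  exact ⟨pushout.inl i f ≫ r, by
    rw [pushout.condition_assoc, hr, Category.comp_id]⟩

omit H

/-- The class of the `X` with `Ext¹(X, Y) = 0` is closed under extensions. -/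
lemma of_shortExact_left {X' X'' : A} {i : X' ⟶ X} {p : X ⟶ X''} {w : i ≫ p = 0}
    (h : (ShortComplex.mk i p w).ShortExact) (H' : ExtOneVanishes X' Y)
    (H'' : ExtOneVanishes X'' Y) : ExtOneVanishes X Y := by
  refine of_retraction fun L j q wq hL => ?_
  have : Mono i := h.mono_f
  have : Epi p := h.epi_g
  have : Mono j := hL.mono_f
  have : Epi q := hL.epi_g
  have hk := shortExact_kernel (q ≫ p)
  have hjk : j ≫ q ≫ p = 0 := by rw [reassoc_of% wq, zero_comp]
  have e : (kernel.ι (q ≫ p) ≫ q) ≫ p = 0 := by rw [Category.assoc, kernel.condition]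
  -- the short exact sequence `0 ⟶ Y ⟶ kernel (q ≫ p) ⟶ X' ⟶ 0`
  let j' : Y ⟶ kernel (q ≫ p) := kernel.lift _ j hjk
  obtain ⟨q', hq'⟩ := h.exact.lift' _ e
  have hq' : q' ≫ i = kernel.ι (q ≫ p) ≫ q := hq'
  have hj' : j' ≫ kernel.ι (q ≫ p) = j := kernel.lift_ι _ _ _
  have w' : j' ≫ q' = 0 := by
    rw [← cancel_mono i, Category.assoc, hq', reassoc_of% hj', wq, zero_comp]
  have hs : (ShortComplex.mk j' q' w').ShortExact := by
    have hlift : pullback.fst q i ≫ q ≫ p = 0 := by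
      rw [pullback.condition_assoc, w, comp_zero]
    -- `q'` is epi because the base change of the epimorphism `q` along `i` factors through it.
    have hc : kernel.lift (q ≫ p) (pullback.fst q i) hlift ≫ q' = pullback.snd q i := by
      rw [← cancel_mono i, Category.assoc, hq', kernel.lift_ι_assoc, pullback.condition]
    have : Epi q' := by
      have : Epi (kernel.lift (q ≫ p) (pullback.fst q i) hlift ≫ q') := by
        rw [hc]; infer_instance
      exact epi_of_epi (kernel.lift (q ≫ p) (pullback.fst q i) hlift) q'
    have : Mono j' := by
      have : Mono (j' ≫ kernel.ι (q ≫ p)) := by rw [hj']; infer_instance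
      exact mono_of_mono j' (kernel.ι (q ≫ p))
    refine ⟨ShortComplex.exact_of_f_is_kernel _ (KernelFork.IsLimit.ofι' _ _ fun {W} k hk => ?_)⟩
    have hk' : k ≫ q' = 0 := hk
    have e : (k ≫ kernel.ι (q ≫ p)) ≫ q = 0 := by
      rw [Category.assoc, ← hq', reassoc_of% hk', zero_comp]
    refine ⟨hL.exact.lift _ e, ?_⟩
    have e2 : hL.exact.lift _ e ≫ j = k ≫ kernel.ι (q ≫ p) := hL.exact.lift_f _ e
    change hL.exact.lift _ e ≫ j' = k
    rw [← cancel_mono (kernel.ι (q ≫ p)), Category.assoc, hj', e2]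
  -- A retraction exists on the preimage of `X'` in `L`; it extends to `L` because the quotient of
  -- `L` by that preimage is `X''`.
  obtain ⟨r, hr⟩ := H'.exists_retraction hs
  obtain ⟨g, hg⟩ := H''.exists_extension hk r
  exact ⟨g, by rw [← hj', Category.assoc, hg, hr]⟩

lemma of_iso {X' Y' : A} (e : X ≅ X') (e' : Y ≅ Y') (H : ExtOneVanishes X Y) :
    ExtOneVanishes X' Y' := by
  refine of_retraction fun L i p w h => ?_
  have hs : (ShortComplex.mk (e'.hom ≫ i) (p ≫ e.inv) (by simp [reassoc_of% w])).ShortExact :=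
    ShortComplex.shortExact_of_iso (ShortComplex.isoMk
      (S₁ := ShortComplex.mk i p w) (S₂ := ShortComplex.mk (e'.hom ≫ i) (p ≫ e.inv) _)
      e'.symm (Iso.refl _) e.symm (by simp) (by simp)) h
  obtain ⟨r, hr⟩ := H.exists_retraction hs
  exact ⟨r ≫ e'.hom, by
    rw [← cancel_epi e'.hom, ← Category.assoc, ← Category.assoc, hr]; simp⟩

end ExtOneVanishes

end Cotorsion

end

end LocallyProjective

namespace LocallyProjective

noncomputable section

/-! ### Leading coordinates, and projective modules over a principal ideal domain -/

section Triangular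

/-- Well-founded elimination of leading coordinates: if every `v` in `N` with leading index at most
`i` agrees with an element of `G` up to an element of `N` with leading index less than `i`, then
`N ≤ G`. -/
lemma addSubgroup_le_of_triangular {ι R Q : Type*} [LinearOrder ι] [WellFoundedLT ι] [Ring R]
    [AddCommGroup Q] [Module R Q] (b : Module.Basis ι R Q) (N G : AddSubgroup Q)
    (h : ∀ i, ∀ v ∈ N, (∀ j, i < j → b.repr v j = 0) →
      ∃ w ∈ G, v - w ∈ N ∧ ∀ j, i ≤ j → b.repr (v - w) j = 0) : N ≤ G := by
  classical
  have key : ∀ i, ∀ v ∈ N, (∀ j, i < j → b.repr v j = 0) → v ∈ G := by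
    intro i
    induction i using WellFoundedLT.induction with
    | ind i ih =>
      intro v hv hvi
      obtain ⟨w, hw, hN, hz⟩ := h i v hv hvi
      have hvw : v - w ∈ G := by
        by_cases h0 : (b.repr (v - w)).support.Nonempty
        · refine ih ((b.repr (v - w)).support.max' h0) ?_ _ hN fun j hj => ?_
          · by_contra hlt
            exact Finsupp.mem_support_iff.1 (Finset.max'_mem _ h0) (hz _ (not_lt.1 hlt))
          · by_contra hne
            exact absurd (Finset.le_max' _ j (Finsupp.mem_support_iff.2 hne)) (not_le.2 hj)
        · have h1 : v - w = 0 := by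
            rw [Finset.not_nonempty_iff_eq_empty, Finsupp.support_eq_empty] at h0
            exact b.repr.map_eq_zero_iff.1 h0
          rw [h1]; exact G.zero_mem
      have := G.add_mem hvw hw
      rwa [sub_add_cancel] at this
  intro v hv
  by_cases h0 : (b.repr v).support.Nonempty
  · refine key ((b.repr v).support.max' h0) v hv fun j hj => ?_
    by_contra hne
    exact absurd (Finset.le_max' _ j (Finsupp.mem_support_iff.2 hne)) (not_le.2 hj)
  · have h1 : v = 0 := by
      rw [Finset.not_nonempty_iff_eq_empty, Finsupp.support_eq_empty] at h0
      simpa using h0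
    rw [h1]; exact G.zero_mem

/-- A submodule of a free module over a principal ideal domain is free. -/
theorem free_submodule {R F : Type*} [CommRing R] [IsDomain R] [IsPrincipalIdealRing R]
    [AddCommGroup F] [Module R F] [Module.Free R F] (N : Submodule R F) : Module.Free R N := by
  classical
  let b := Module.Free.chooseBasis R F
  obtain ⟨_, _⟩ := exists_wellFoundedLT (Module.Free.ChooseBasisIndex R F)
  let J : Module.Free.ChooseBasisIndex R F → Submodule R F := fun i =>
    { carrier := {v | v ∈ N ∧ ∀ j, i < j → b.repr v j = 0}
      zero_mem' := ⟨N.zero_mem, fun j _ => by simp⟩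
      add_mem' := fun {v w} hv hw => ⟨N.add_mem hv.1 hw.1, fun j hj => by
        simp [hv.2 j hj, hw.2 j hj]⟩
      smul_mem' := fun a v hv => ⟨N.smul_mem a hv.1, fun j hj => by simp [hv.2 j hj]⟩ }
  -- The `i`-th coordinates of elements of `N` with leading index at most `i` form an ideal, and `z
  -- i` realizes its generator.
  have hg : ∀ i, ∃ z ∈ J i, ∀ v ∈ J i, ∃ a : R, b.repr v i = a * b.repr z i := by
    intro i
    let I : Ideal R := (J i).map (b.coord i)
    have hmem : Submodule.IsPrincipal.generator I ∈ I := Submodule.IsPrincipal.generator_mem I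
    obtain ⟨z, hz, hzg⟩ := hmem
    refine ⟨z, hz, fun v hv => ?_⟩
    have : b.coord i v ∈ I := ⟨v, hv, rfl⟩
    obtain ⟨a, ha⟩ := (Submodule.IsPrincipal.mem_iff_eq_smul_generator I).1 this
    exact ⟨a, by rw [← hzg] at ha; exact ha⟩
  choose z hz hgen using hg
  -- Indices with zero ideal are dropped. The remaining `z i` have pairwise distinct leading
  -- indices, hence are independent; they span by triangular elimination.
  let ι' := {i // b.repr (z i) i ≠ 0}
  have hli : LinearIndependent R (fun i : ι' => z i.1) := by
    rw [linearIndependent_iff]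
    intro l hl
    by_contra hne
    have hn : l.support.Nonempty := Finsupp.support_nonempty_iff.2 hne
    set i := l.support.max' hn with hi
    have h1 : b.repr (Finsupp.linearCombination R (fun i : ι' => z i.1) l) i.1 =
        l i * b.repr (z i.1) i.1 := by
      rw [Finsupp.linearCombination_apply, Finsupp.sum, map_sum, Finsupp.finsetSum_apply,
        Finset.sum_eq_single i]
      · simp
      · intro j hj hji
        have hlt : j.1 < i.1 := lt_of_le_of_ne (Finset.le_max' _ j hj) (Subtype.coe_injective.ne hji)
        simp [(hz j.1).2 _ hlt]
      · intro h
        exact absurd (Finset.max'_mem _ hn) h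
    rw [hl, map_zero, Finsupp.zero_apply] at h1
    exact (mul_ne_zero (Finsupp.mem_support_iff.1 (Finset.max'_mem _ hn)) i.2) h1.symm
  have hspan : Submodule.span R (Set.range fun i : ι' => z i.1) = N := by
    refine le_antisymm (Submodule.span_le.2 ?_) ?_
    · rintro _ ⟨i, rfl⟩
      exact (hz i.1).1
    · refine addSubgroup_le_of_triangular b N.toAddSubgroup
        (Submodule.span R (Set.range fun i : ι' => z i.1)).toAddSubgroup fun i v hv hvi => ?_
      obtain ⟨a, ha⟩ := hgen i v ⟨hv, hvi⟩
      by_cases h0 : b.repr (z i) i = 0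
      · refine ⟨0, Submodule.zero_mem _, by simpa using hv, fun j hj => ?_⟩
        rcases hj.eq_or_lt with rfl | hj
        · simp [ha, h0]
        · simp [hvi j hj]
      · refine ⟨a • z i, Submodule.smul_mem _ _ (Submodule.subset_span ⟨⟨i, h0⟩, rfl⟩),
          N.sub_mem hv (N.smul_mem a (hz i).1), fun j hj => ?_⟩
        rcases hj.eq_or_lt with rfl | hj
        · simp [ha]
        · simp [hvi j hj, (hz i).2 j hj]
  rw [← hspan]
  exact Module.Free.of_basis (Module.Basis.span hli)

theorem free_of_injective_of_projective {R M F : Type*} [CommRing R] [IsDomain R]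
    [IsPrincipalIdealRing R] [AddCommGroup F] [Module R F] [AddCommGroup M] [Module R M]
    (hF : Module.Projective R F) (f : M →ₗ[R] F) (hf : Function.Injective f) :
    Module.Free R M := by
  obtain ⟨s, hs⟩ := (Module.projective_def' (R := R) (P := F)).1 hF
  have hs' : Function.Injective s := fun x y h => by
    have := congrArg (Finsupp.linearCombination R id) h
    rwa [← LinearMap.comp_apply, ← LinearMap.comp_apply, hs] at this
  have := free_submodule (LinearMap.range (s.comp f))
  exact Module.Free.of_equiv (LinearEquiv.ofInjective (s.comp f) (hs'.comp hf)).symm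

end Triangular

section Module

variable {R X Y Z : Type*} [Ring R] [AddCommGroup X] [AddCommGroup Y] [AddCommGroup Z]
  [Module R X] [Module R Y] [Module R Z]

/-- The cokernel of a split injection into a projective module is projective. -/
lemma projective_of_retraction [Module.Projective R Y] (f : X →ₗ[R] Y) (g : Y →ₗ[R] Z)
    (hg : Function.Surjective g) (hfg : ∀ y, g y = 0 ↔ ∃ x, f x = y) (r : Y →ₗ[R] X)
    (hr : ∀ x, r (f x) = x) : Module.Projective R Z := by
  have hk : LinearMap.ker g ≤ LinearMap.ker (LinearMap.id - f.comp r) := fun y hy => by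
    obtain ⟨x, rfl⟩ := (hfg y).1 hy
    simp [hr]
  let e := g.quotKerEquivOfSurjective hg
  refine Module.Projective.of_split (((LinearMap.ker g).liftQ _ hk).comp e.symm.toLinearMap) g ?_
  ext z
  obtain ⟨y, rfl⟩ := hg z
  have he : e.symm (g y) = Submodule.Quotient.mk y := e.symm_apply_apply (Submodule.Quotient.mk y)
  have h0 : g (f (r y)) = 0 := (hfg _).2 ⟨_, rfl⟩
  simp [he, h0]

/-- An extension of projective modules is projective. -/
lemma projective_of_extension [Module.Projective R X] [Module.Projective R Z] (f : X →ₗ[R] Y)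
    (g : Y →ₗ[R] Z) (hf : Function.Injective f) (hg : Function.Surjective g)
    (hfg : ∀ y, g y = 0 ↔ ∃ x, f x = y) : Module.Projective R Y := by
  obtain ⟨s, hs⟩ := Module.projective_lifting_property g LinearMap.id hg
  have hex : Function.Exact f g := fun y => (hfg y)
  have hs' : ∀ z, g (s z) = z := fun z => LinearMap.congr_fun hs z
  let e := LinearEquiv.ofBijective (f.coprod s) ⟨by
    rw [← LinearMap.ker_eq_bot, LinearMap.ker_eq_bot']
    rintro ⟨x, z⟩ h
    have h1 : f x + s z = 0 := by simpa using h
    have h2 := congrArg g h1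
    rw [map_add, (hfg _).2 ⟨x, rfl⟩, hs', zero_add, map_zero] at h2
    subst h2
    rw [map_zero, add_zero] at h1
    rw [hf (h1.trans (map_zero f).symm)]
    rfl, fun y => by
    obtain ⟨x, hx⟩ := (hfg (y - s (g y))).1 (by rw [map_sub, hs', sub_self])
    exact ⟨(x, g y), by simp [hx]⟩⟩
  exact Module.Projective.of_equiv e

end Module

end

end LocallyProjective

namespace LocallyProjective

noncomputable section

/-! ### Bases under localization, and componentwise exactness of sheaves -/

section Localization

variable {A B : Type u} [CommRing A] [CommRing B] {φ : A →+* B}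

/-- A basis of a module is mapped to a basis of its localization. -/
lemma exists_basis_of_isLocalizedModule (S : Submonoid A)
    (hφ : @IsLocalization A _ S B _ φ.toAlgebra) {M : ModuleCat.{u} A} {P : ModuleCat.{u} B}
    (f : M ⟶ (ModuleCat.restrictScalars φ).obj P) (hf : IsLocalizedModule S f.hom) {ι : Type*}
    (b : Module.Basis ι A M) : ∃ b' : Module.Basis ι B P, ∀ i, b' i = resFun f (b i) := by
  let _ : Algebra A B := φ.toAlgebra
  let _ : Module A P := Module.compHom P φ
  have : IsScalarTower A B P := ⟨fun a b p => mul_smul (φ a) b p⟩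
  let f' : M →ₗ[A] P :=
    { toFun := resFun f
      map_add' := (resFun f).map_add
      map_smul' := fun a m => resFun_smul f a m }
  have : IsLocalizedModule S f' := hf
  exact ⟨b.ofIsLocalizedModule B S f', fun i => b.ofIsLocalizedModule_apply B S f' i⟩

end Localization

variable (k : Type u) [Field k]

lemma isLocalization_inclPos : @IsLocalization _ _ (Submonoid.powers (Polynomial.X : k[X]))
    k[T;T⁻¹] _ (inclPos k).toAlgebra :=
  LaurentPolynomial.isLocalization

lemma isLocalization_inclNeg : @IsLocalization _ _ (Submonoid.powers (Polynomial.X : k[X]))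
    k[T;T⁻¹] _ (inclNeg k).toAlgebra := by
  let _ := (inclNeg k).toAlgebra
  refine (isLocalization_iff _ _).2 ⟨?_, ?_, @fun p q h => ?_⟩
  · rintro ⟨_, n, rfl⟩
    change IsUnit (inclNeg k (Polynomial.X ^ n))
    rw [map_pow]
    exact (isUnit_inclNeg k).pow n
  · intro p
    obtain ⟨N, q, hq⟩ := LaurentPolynomial.exists_T_pow (LaurentPolynomial.invert p)
    refine ⟨⟨q, ⟨_, N, rfl⟩⟩, ?_⟩
    change p * inclNeg k (Polynomial.X ^ N) = LaurentPolynomial.invert (Polynomial.toLaurent q)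
    rw [hq, map_pow, inclNeg_X, LaurentPolynomial.T_pow, map_mul, LaurentPolynomial.invert_T,
      LaurentPolynomial.involutive_invert, mul_neg_one]
  · have h1 : LaurentPolynomial.invert (Polynomial.toLaurent p) =
      LaurentPolynomial.invert (Polynomial.toLaurent q) := h
    have h2 := Polynomial.toLaurent_injective ((LaurentPolynomial.invert (R := k)).injective h1)
    exact ⟨1, by rw [h2]⟩

variable {k}

namespace QcoP1

variable {F G H : QcoP1 k}

/-- A basis of the sections over `Spec k[x]` is a basis of the sections over `Spec k[x, x⁻¹]`. -/
lemma exists_basis_P_of_M (F : QcoP1 k) {ι : Type*} (b : Module.Basis ι k[X] F.M) :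
    ∃ b' : Module.Basis ι k[T;T⁻¹] F.P, ∀ i, b' i = F.s (b i) :=
  exists_basis_of_isLocalizedModule _ (isLocalization_inclPos k) F.σ F.isLocalizedModule_σ b

lemma exists_basis_P_of_N (F : QcoP1 k) {ι : Type*} (b : Module.Basis ι k[X] F.N) :
    ∃ b' : Module.Basis ι k[T;T⁻¹] F.P, ∀ i, b' i = F.t (b i) :=
  exists_basis_of_isLocalizedModule _ (isLocalization_inclNeg k) F.τ F.isLocalizedModule_τ b

lemma surj_of_shortExact {S : ShortComplex (QcoP1 k)} (h : S.ShortExact) :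
    Function.Surjective S.g.hM.hom ∧ Function.Surjective S.g.hP.hom ∧
      Function.Surjective S.g.hN.hom :=
  have := h.epi_g
  surjective_of_epi S.g

lemma inj_of_shortExact {S : ShortComplex (QcoP1 k)} (h : S.ShortExact) :
    Function.Injective S.f.hM.hom ∧ Function.Injective S.f.hP.hom ∧
      Function.Injective S.f.hN.hom :=
  have := h.mono_f
  injective_of_mono S.f

lemma exact_of_shortExact {S : ShortComplex (QcoP1 k)} (h : S.ShortExact) :
    (∀ m, S.g.hM.hom m = 0 ↔ ∃ m', S.f.hM.hom m' = m) ∧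
      (∀ m, S.g.hP.hom m = 0 ↔ ∃ m', S.f.hP.hom m' = m) ∧
        (∀ m, S.g.hN.hom m = 0 ↔ ∃ m', S.f.hN.hom m' = m) := by
  have := h.mono_f
  obtain ⟨l, hl⟩ := h.exact.lift' (kerι S.g) (kerι_comp S.g)
  refine ⟨fun m => ⟨fun hm => ⟨l.hM.hom ⟨m, hm⟩, congr($(congrArg Hom.hM hl).hom ⟨m, hm⟩)⟩, ?_⟩,
    fun m => ⟨fun hm => ⟨l.hP.hom ⟨m, hm⟩, congr($(congrArg Hom.hP hl).hom ⟨m, hm⟩)⟩, ?_⟩,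
    fun m => ⟨fun hm => ⟨l.hN.hom ⟨m, hm⟩, congr($(congrArg Hom.hN hl).hom ⟨m, hm⟩)⟩, ?_⟩⟩
  · rintro ⟨m, rfl⟩; exact congr($(congrArg Hom.hM S.zero).hom m)
  · rintro ⟨m, rfl⟩; exact congr($(congrArg Hom.hP S.zero).hom m)
  · rintro ⟨m, rfl⟩; exact congr($(congrArg Hom.hN S.zero).hom m)

/-- Short exactness can be checked componentwise. -/
lemma shortExact_of_components {S : ShortComplex (QcoP1 k)}
    (f1 : Function.Injective S.f.hM.hom) (f2 : Function.Injective S.f.hP.hom)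
    (f3 : Function.Injective S.f.hN.hom) (g1 : Function.Surjective S.g.hM.hom)
    (g2 : Function.Surjective S.g.hP.hom) (g3 : Function.Surjective S.g.hN.hom)
    (e1 : ∀ m, S.g.hM.hom m = 0 → ∃ m', S.f.hM.hom m' = m)
    (e2 : ∀ m, S.g.hP.hom m = 0 → ∃ m', S.f.hP.hom m' = m)
    (e3 : ∀ m, S.g.hN.hom m = 0 → ∃ m', S.f.hN.hom m' = m) : S.ShortExact := by
  have hf : Mono S.f := mono_of_injective _ f1 f2 f3
  have hg : Epi S.g := epi_of_surjective _ g1 g2 g3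
  refine ⟨ShortComplex.exact_of_f_is_kernel _ (KernelFork.IsLimit.ofι' _ _ fun {W} h hh => ?_)⟩
  have w : h ≫ cokerπ S.f = 0 := by
    ext m
    · exact (Submodule.Quotient.mk_eq_zero _).2 (e1 _ congr($(congrArg Hom.hM hh).hom m))
    · exact (Submodule.Quotient.mk_eq_zero _).2 (e2 _ congr($(congrArg Hom.hP hh).hom m))
    · exact (Submodule.Quotient.mk_eq_zero _).2 (e3 _ congr($(congrArg Hom.hN hh).hom m))
  exact ⟨monoLift S.f h w, monoLift_comp S.f h w⟩

/-! ### Closure properties of locally projective sheaves -/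

section LocallyProjective

/-- The condition on `P` is automatic: a projective `k[x]`-module is free, and a basis of `M`
localizes to a basis of `P`. -/
lemma locallyProjective_of_M_N (h1 : Module.Projective k[X] F.M)
    (h2 : Module.Projective k[X] F.N) : locallyProjective k F := by
  refine ⟨h1, ?_, h2⟩
  have := free_of_injective_of_projective h1 LinearMap.id Function.injective_id
  obtain ⟨b, _⟩ := F.exists_basis_P_of_M (Module.Free.chooseBasis k[X] F.M)
  exact Module.Projective.of_basis b

lemma free_M (h : locallyProjective k F) : Module.Free k[X] F.M :=
  free_of_injective_of_projective h.1 LinearMap.id Function.injective_id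

lemma free_N (h : locallyProjective k F) : Module.Free k[X] F.N :=
  free_of_injective_of_projective h.2.2 LinearMap.id Function.injective_id

/-- Subsheaves of locally projective sheaves are locally projective. -/
lemma locallyProjective_of_mono (f : F ⟶ G) [Mono f] (h : locallyProjective k G) :
    locallyProjective k F := by
  obtain ⟨h1, _, h3⟩ := injective_of_mono f
  have := free_of_injective_of_projective h.1 f.hM.hom h1
  have := free_of_injective_of_projective h.2.2 f.hN.hom h3
  exact locallyProjective_of_M_N inferInstance inferInstance

lemma locallyProjective_of_extension {S : ShortComplex (QcoP1 k)} (h : S.ShortExact)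
    (h1 : locallyProjective k S.X₁) (h3 : locallyProjective k S.X₃) :
    locallyProjective k S.X₂ := by
  obtain ⟨i1, _, i3⟩ := inj_of_shortExact h
  obtain ⟨p1, _, p3⟩ := surj_of_shortExact h
  obtain ⟨e1, _, e3⟩ := exact_of_shortExact h
  have := h1.1; have := h1.2.2; have := h3.1; have := h3.2.2
  exact locallyProjective_of_M_N (projective_of_extension S.f.hM.hom S.g.hM.hom i1 p1 e1)
    (projective_of_extension S.f.hN.hom S.g.hN.hom i3 p3 e3)

/-- A morphism which has linear retractions over the two affine charts. -/
def LocallySplit (f : F ⟶ G) : Prop :=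
  (∃ r : G.M →ₗ[k[X]] F.M, ∀ m, r (f.hM.hom m) = m) ∧
    ∃ r : G.N →ₗ[k[X]] F.N, ∀ m, r (f.hN.hom m) = m

lemma LocallySplit.of_comp {f : F ⟶ G} {g : G ⟶ H} (h : LocallySplit (f ≫ g)) :
    LocallySplit f := by
  obtain ⟨⟨r, hr⟩, ⟨r', hr'⟩⟩ := h
  exact ⟨⟨r.comp g.hM.hom, hr⟩, ⟨r'.comp g.hN.hom, hr'⟩⟩

/-- Projectivity is tested chart by chart, so retractions over the charts suffice; they need not
agree on the intersection. -/
lemma LocallySplit.locallyProjective {S : ShortComplex (QcoP1 k)} (h : S.ShortExact)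
    (hf : LocallySplit S.f) (h2 : locallyProjective k S.X₂) : locallyProjective k S.X₃ := by
  obtain ⟨⟨r, hr⟩, ⟨r', hr'⟩⟩ := hf
  obtain ⟨p1, _, p3⟩ := surj_of_shortExact h
  obtain ⟨e1, _, e3⟩ := exact_of_shortExact h
  have := h2.1; have := h2.2.2
  exact locallyProjective_of_M_N (projective_of_retraction S.f.hM.hom S.g.hM.hom p1 e1 r hr)
    (projective_of_retraction S.f.hN.hom S.g.hN.hom p3 e3 r' hr')

lemma locallyProjective_twist (n : ℤ) : locallyProjective k (twist k n) :=
  locallyProjective_of_M_N (inferInstanceAs (Module.Projective k[X] k[X]))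
    (inferInstanceAs (Module.Projective k[X] k[X]))

lemma locallyProjective_of_isZero (h : IsZero F) : locallyProjective k F :=
  have : Mono (0 : F ⟶ twist k 0) := ⟨fun _ _ _ => h.eq_of_tgt _ _⟩
  locallyProjective_of_mono (0 : F ⟶ twist k 0) (locallyProjective_twist 0)

/-- If the identity of `F` factors through `G` and `H` in the form `a ≫ a' + b ≫ b'`, then `F` is
locally projective as soon as `G` and `H` are. -/
lemma locallyProjective_of_decomp (a : F ⟶ G) (a' : G ⟶ F) (b : F ⟶ H) (b' : H ⟶ F)
    (e : a ≫ a' + b ≫ b' = 𝟙 F) (hG : locallyProjective k G) (hH : locallyProjective k H) :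
    locallyProjective k F := by
  have e1 : ∀ m, a'.hM.hom (a.hM.hom m) + b'.hM.hom (b.hM.hom m) = m := fun m =>
    congr($(congrArg Hom.hM e).hom m)
  have e3 : ∀ m, a'.hN.hom (a.hN.hom m) + b'.hN.hom (b.hN.hom m) = m := fun m =>
    congr($(congrArg Hom.hN e).hom m)
  have := hG.1; have := hG.2.2; have := hH.1; have := hH.2.2
  exact locallyProjective_of_M_N
    (Module.Projective.of_split (a.hM.hom.prod b.hM.hom) (a'.hM.hom.coprod b'.hM.hom)
      (by ext m; exact e1 m))
    (Module.Projective.of_split (a.hN.hom.prod b.hN.hom) (a'.hN.hom.coprod b'.hN.hom)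
      (by ext m; exact e3 m))

end LocallyProjective

/-! ### The sheaves `𝒪(n)` as generators -/

section Twist

open LaurentPolynomial

lemma inclPos_X_pow (n : ℕ) : inclPos k Polynomial.X ^ n = T (n : ℤ) := by
  rw [inclPos_X, T_pow, mul_one]

lemma inclNeg_X_pow (n : ℕ) : inclNeg k Polynomial.X ^ n = T (-(n : ℤ)) := by
  rw [inclNeg_X, T_pow, mul_neg_one]

lemma T_smul_T_smul {Q : Type*} [AddCommGroup Q] [Module k[T;T⁻¹] Q] (m n : ℤ) (p : Q) :
    (T m : k[T;T⁻¹]) • (T n : k[T;T⁻¹]) • p = (T (m + n) : k[T;T⁻¹]) • p := by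
  rw [smul_smul, T_add]

lemma T_zero_smul {Q : Type*} [AddCommGroup Q] [Module k[T;T⁻¹] Q] (p : Q) : (T 0 : k[T;T⁻¹]) • p = p := by
  rw [T_zero, one_smul]

/-- High multiples of a section over `Spec k[x, x⁻¹]` by powers of `x` extend to `Spec k[x]`. -/
lemma exists_T_smul_eq_s (F : QcoP1 k) (p : F.P) :
    ∃ N : ℤ, ∀ n, N ≤ n → ∃ m, (T n : k[T;T⁻¹]) • p = F.s m := by
  obtain ⟨N, m, h⟩ := F.s_surj p
  refine ⟨N, fun n hn => ⟨(Polynomial.X : k[X]) ^ (n - N).toNat • m, ?_⟩⟩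
  rw [s_smul, ← h, map_pow, inclPos_X_pow, inclPos_X_pow, T_smul_T_smul,
    Int.toNat_of_nonneg (by lia), sub_add_cancel]

lemma exists_T_smul_eq_t (F : QcoP1 k) (p : F.P) :
    ∃ N : ℤ, ∀ n, n ≤ N → ∃ y, (T n : k[T;T⁻¹]) • p = F.t y := by
  obtain ⟨N, m, h⟩ := F.t_surj p
  refine ⟨-N, fun n hn => ⟨(Polynomial.X : k[X]) ^ (-N - n).toNat • m, ?_⟩⟩
  rw [t_smul, ← h, map_pow, inclNeg_X_pow, inclNeg_X_pow, T_smul_T_smul,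
    Int.toNat_of_nonneg (by lia)]
  congr 2; lia

/-- The generator of `𝒪(n)` over `Spec k[x]`. -/
def genM (n : ℤ) : (twist k n).M := (1 : k[X])
/-- The generator of `𝒪(n)` over `Spec k[x⁻¹]`. -/
def genN (n : ℤ) : (twist k n).N := (1 : k[X])

lemma t_genN (n : ℤ) : (twist k n).t (genN n) = (T n : k[T;T⁻¹]) • (twist k n).s (genM n) := by
  change (T n * inclNeg k 1 : k[T;T⁻¹]) = T n * inclPos k 1
  rw [map_one, map_one]

/-- The morphism `𝒪(n) ⟶ F` given by compatible sections. -/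
def ofSections (n : ℤ) (m : F.M) (y : F.N) (h : F.t y = (T n : k[T;T⁻¹]) • F.s m) :
    twist k n ⟶ F :=
  homMk (F := twist k n) (LinearMap.toSpanSingleton k[X] F.M m)
    (LinearMap.toSpanSingleton k[T;T⁻¹] F.P (F.s m)) (LinearMap.toSpanSingleton k[X] F.N y)
    (fun q => (F.s_smul q m).symm)
    (fun q => by
      change (T n * inclNeg k q : k[T;T⁻¹]) • F.s m = F.t ((show k[X] from q) • y)
      rw [t_smul, h, smul_smul, mul_comm])

lemma ofSections_hM (n : ℤ) (m : F.M) (y : F.N) (h : F.t y = (T n : k[T;T⁻¹]) • F.s m) :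
    (ofSections n m y h).hM.hom (genM n) = m := one_smul _ _
lemma ofSections_hN (n : ℤ) (m : F.M) (y : F.N) (h : F.t y = (T n : k[T;T⁻¹]) • F.s m) :
    (ofSections n m y h).hN.hom (genN n) = y := one_smul _ _

lemma twist_hom_ext {n : ℤ} {f g : twist k n ⟶ F}
    (h : f.hM.hom (genM n) = g.hM.hom (genM n))
    (h' : f.hN.hom (genN n) = g.hN.hom (genN n)) : f = g := by
  have hP := congrArg F.s h
  rw [← hP_s, ← hP_s] at hP
  have e : (twist k n).s (genM n) = (1 : k[T;T⁻¹]) := map_one (inclPos k)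
  rw [e] at hP
  ext1
  · exact ModuleCat.hom_ext (LinearMap.ext_ring h)
  · exact ModuleCat.hom_ext (LinearMap.ext_ring hP)
  · exact ModuleCat.hom_ext (LinearMap.ext_ring h')

/-- After multiplication by a sufficiently negative power of `x`, a section over one chart extends
to the other. Hence every section over a chart is the image of the generator of some `𝒪(n)`. -/
lemma exists_compatible_of_M (F : QcoP1 k) (m : F.M) :
    ∃ (n : ℤ) (y : F.N), F.t y = (T n : k[T;T⁻¹]) • F.s m := by
  obtain ⟨N, h⟩ := F.exists_T_smul_eq_t (F.s m)
  obtain ⟨y, hy⟩ := h N le_rfl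
  exact ⟨N, y, hy.symm⟩

lemma exists_compatible_of_N (F : QcoP1 k) (y : F.N) :
    ∃ (n : ℤ) (m : F.M), F.t y = (T n : k[T;T⁻¹]) • F.s m := by
  obtain ⟨N, h⟩ := F.exists_T_smul_eq_s (F.t y)
  obtain ⟨m, hm⟩ := h N le_rfl
  exact ⟨-N, m, by rw [← hm, T_smul_T_smul, neg_add_cancel, T_zero_smul]⟩

/-- A morphism is an epimorphism if it is surjective over the two affine charts. -/
lemma epi_of_surjective_M_N (f : F ⟶ G) (h1 : Function.Surjective f.hM.hom)
    (h3 : Function.Surjective f.hN.hom) : Epi f := by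
  refine epi_of_surjective f h1 (fun p => ?_) h3
  obtain ⟨N, h⟩ := G.exists_T_smul_eq_s p
  obtain ⟨m, hm⟩ := h N le_rfl
  obtain ⟨m, rfl⟩ := h1 m
  refine ⟨(T (-N) : k[T;T⁻¹]) • F.s m, ?_⟩
  rw [map_smul, hP_s, ← hm, T_smul_T_smul, neg_add_cancel, T_zero_smul]

/-- The sheaves `𝒪(n)` generate. -/
lemma epi_of_lift_twist (f : F ⟶ G)
    (h : ∀ (n : ℤ) (g : twist k n ⟶ G), ∃ g' : twist k n ⟶ F, g' ≫ f = g) : Epi f := by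
  refine epi_of_surjective_M_N f (fun m => ?_) (fun y => ?_)
  · obtain ⟨n, y, hy⟩ := G.exists_compatible_of_M m
    obtain ⟨g, hg⟩ := h n (ofSections n m y hy)
    exact ⟨g.hM.hom (genM n), (congr($(congrArg Hom.hM hg).hom (genM n))).trans
      (ofSections_hM n m y hy)⟩
  · obtain ⟨n, m, hm⟩ := G.exists_compatible_of_N y
    obtain ⟨g, hg⟩ := h n (ofSections n m y hm)
    exact ⟨g.hN.hom (genN n), (congr($(congrArg Hom.hN hg).hom (genN n))).trans
      (ofSections_hN n m y hm)⟩

end Twist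

end QcoP1

end

end LocallyProjective

namespace LocallyProjective

noncomputable section

variable {k : Type u} [Field k]

/-! ### Čech cohomology of the twists, and extensions of `𝒪(n)` -/

namespace QcoP1

open LaurentPolynomial

variable {F G H : QcoP1 k}

/-- The vanishing of the first Čech cohomology of all twists of `F`. -/
def TwistsAcyclic (F : QcoP1 k) : Prop :=
  ∀ (n : ℤ) (p : F.P), ∃ (m : F.M) (y : F.N), p = F.s m + (T n : k[T;T⁻¹]) • F.t y

lemma TwistsAcyclic.of_shortExact {S : ShortComplex (QcoP1 k)} (h : S.ShortExact)
    (h1 : TwistsAcyclic S.X₁) (h3 : TwistsAcyclic S.X₃) : TwistsAcyclic S.X₂ := by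
  intro n p
  obtain ⟨p1, _, p3⟩ := surj_of_shortExact h
  obtain ⟨_, e2, _⟩ := exact_of_shortExact h
  obtain ⟨m, y, hp⟩ := h3 n (S.g.hP.hom p)
  obtain ⟨m, rfl⟩ := p1 m
  obtain ⟨y, rfl⟩ := p3 y
  obtain ⟨p', hp'⟩ := (e2 (p - (S.X₂.s m + (T n : k[T;T⁻¹]) • S.X₂.t y))).1 (by
    rw [map_sub, map_add, map_smul, hP_s, hP_t, ← hp, sub_self])
  obtain ⟨m', y', h'⟩ := h1 n p'
  refine ⟨S.f.hM.hom m' + m, S.f.hN.hom y' + y, ?_⟩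
  rw [h', map_add, map_smul, hP_s, hP_t] at hp'
  rw [map_add, map_add, smul_add, add_add_add_comm, hp', sub_add_cancel]

/-- `H¹` is the cokernel of the Čech map, hence right exact; there is no `H²` on a cover by two
charts. -/
lemma TwistsAcyclic.of_epi (f : F ⟶ G) [Epi f] (h : TwistsAcyclic F) : TwistsAcyclic G := by
  intro n p
  obtain ⟨p, rfl⟩ := (surjective_of_epi f).2.1 p
  obtain ⟨m, y, rfl⟩ := h n p
  exact ⟨f.hM.hom m, f.hN.hom y, by rw [map_add, map_smul, hP_s, hP_t]⟩

lemma TwistsAcyclic.of_decomp (a : F ⟶ G) (a' : G ⟶ F) (b : F ⟶ H) (b' : H ⟶ F)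
    (e : a ≫ a' + b ≫ b' = 𝟙 F) (hG : TwistsAcyclic G) (hH : TwistsAcyclic H) :
    TwistsAcyclic F := by
  intro n p
  have e2 : a'.hP.hom (a.hP.hom p) + b'.hP.hom (b.hP.hom p) = p :=
    congr($(congrArg Hom.hP e).hom p)
  obtain ⟨m, y, h⟩ := hG n (a.hP.hom p)
  obtain ⟨m', y', h'⟩ := hH n (b.hP.hom p)
  refine ⟨a'.hM.hom m + b'.hM.hom m', a'.hN.hom y + b'.hN.hom y', ?_⟩
  conv_lhs => rw [← e2, h, h']
  simp only [map_add, map_smul, hP_s, hP_t, smul_add]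
  abel

/-- The extension of `𝒪(n)` by `F` with gluing cocycle `p`. -/
def extension (F : QcoP1 k) (n : ℤ) (p : F.P) : QcoP1 k :=
  mk' (ModuleCat.of _ (F.M × k[X])) (ModuleCat.of _ (F.P × k[T;T⁻¹]))
    (ModuleCat.of _ (F.N × k[X]))
    { toFun := fun m => (F.s m.1, inclPos k m.2)
      map_zero' := by simp
      map_add' := fun m m' => by simp }
    { toFun := fun m => (F.t m.1 + inclNeg k m.2 • p, T n * inclNeg k m.2)
      map_zero' := by simp
      map_add' := fun m m' => by
        simp only [Prod.fst_add, Prod.snd_add, map_add, add_smul, mul_add, Prod.mk_add_mk]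
        rw [add_add_add_comm] }
    (fun a m => Prod.ext (F.s_smul a m.1) (map_mul (inclPos k) a m.2))
    (fun a m => Prod.ext
      (by
        change F.t (a • m.1) + inclNeg k (a * m.2) • p = inclNeg k a • (F.t m.1 + inclNeg k m.2 • p)
        rw [t_smul, smul_add, map_mul, mul_smul])
      (by
        change T n * inclNeg k (a * m.2) = inclNeg k a * (T n * inclNeg k m.2)
        rw [map_mul, mul_left_comm]))
    (fun q => by
      obtain ⟨N, h⟩ := F.exists_T_smul_eq_s q.1
      obtain ⟨N', h'⟩ := (twist k n).exists_T_smul_eq_s q.2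
      have e1 : N ≤ ((max N N').toNat : ℤ) := le_trans (le_max_left _ _) (Int.self_le_toNat _)
      have e2 : N' ≤ ((max N N').toNat : ℤ) := le_trans (le_max_right _ _) (Int.self_le_toNat _)
      obtain ⟨m, hm⟩ := h _ e1
      obtain ⟨m', hm'⟩ := h' _ e2
      exact ⟨(max N N').toNat, (m, m'), by rw [inclPos_X_pow]; exact Prod.ext hm hm'⟩)
    (fun m h => by
      obtain ⟨n1, h1⟩ := F.s_inj m.1 (congrArg Prod.fst h)
      have h2 : m.2 = 0 := Polynomial.toLaurent_injective
        ((congrArg Prod.snd h).trans (map_zero (inclPos k)).symm)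
      exact ⟨n1, Prod.ext h1 ((congrArg _ h2).trans (smul_zero _))⟩)
    (fun q => by
      -- The pole of the `𝒪(n)`-coordinate is cleared first. This introduces a multiple of `p` in
      -- the other coordinate, whose pole is cleared after subtracting it.
      obtain ⟨b, (z : k[X]), hz⟩ := (twist k n).t_surj q.2
      obtain ⟨c, y, hy⟩ := F.t_surj (inclNeg k Polynomial.X ^ b • q.1 - inclNeg k z • p)
      refine ⟨c + b, (y, (Polynomial.X : k[X]) ^ c * z), Prod.ext ?_ ?_⟩
      · change inclNeg k Polynomial.X ^ (c + b) • q.1 = F.t y + inclNeg k (_ * z) • p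
        rw [← hy, smul_sub, map_mul, map_pow, smul_smul, smul_smul, pow_add, sub_add_cancel]
      · change inclNeg k Polynomial.X ^ (c + b) * q.2 = T n * inclNeg k (_ * z)
        have hz' : inclNeg k Polynomial.X ^ b * q.2 = T n * inclNeg k z := hz
        rw [pow_add, mul_assoc, hz', map_mul, map_pow, mul_left_comm])
    (fun m h => by
      have h2 : m.2 = 0 := by
        have h1 : T n * inclNeg k m.2 = 0 := congrArg Prod.snd h
        rw [(LaurentPolynomial.isUnit_T n).mul_right_eq_zero] at h1
        exact Polynomial.toLaurent_injective (((LaurentPolynomial.invert (R := k)).injective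
          (h1.trans (map_zero _).symm)).trans (map_zero _).symm)
      have h3 : F.t m.1 + inclNeg k m.2 • p = 0 := congrArg Prod.fst h
      rw [h2, map_zero, zero_smul, add_zero] at h3
      obtain ⟨n1, h1⟩ := F.t_inj m.1 h3
      exact ⟨n1, Prod.ext h1 ((congrArg _ h2).trans (smul_zero _))⟩)

/-- The inclusion of `F` in an extension. -/
def extensionι (F : QcoP1 k) (n : ℤ) (p : F.P) : F ⟶ extension F n p :=
  homMk (G := extension F n p) (LinearMap.inl _ _ _) (LinearMap.inl _ _ _) (LinearMap.inl _ _ _)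
    (fun m => Prod.ext rfl (map_zero (inclPos k)).symm)
    (fun y => Prod.ext
      (by
        change F.t y = F.t y + inclNeg k 0 • p
        rw [map_zero, zero_smul, add_zero])
      (by
        change 0 = T n * inclNeg k 0
        rw [map_zero, mul_zero]))

/-- The projection of an extension to `𝒪(n)`. -/
def extensionπ (F : QcoP1 k) (n : ℤ) (p : F.P) : extension F n p ⟶ twist k n :=
  homMk (F := extension F n p) (G := twist k n) (LinearMap.snd k[X] F.M k[X])
    (LinearMap.snd k[T;T⁻¹] F.P k[T;T⁻¹]) (LinearMap.snd k[X] F.N k[X])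
    (fun _ => rfl) (fun _ => rfl)

lemma extension_shortExact (F : QcoP1 k) (n : ℤ) (p : F.P) :
    (ShortComplex.mk (extensionι F n p) (extensionπ F n p) (by ext m <;> rfl)).ShortExact :=
  shortExact_of_components (LinearMap.inl_injective (R := k[X]))
    (LinearMap.inl_injective (R := k[T;T⁻¹])) (LinearMap.inl_injective (R := k[X]))
    (fun q => ⟨(0, q), rfl⟩) (fun q => ⟨(0, q), rfl⟩) (fun q => ⟨(0, q), rfl⟩)
    (fun m hm => ⟨m.1, Prod.ext rfl (Eq.symm hm)⟩) (fun m hm => ⟨m.1, Prod.ext rfl (Eq.symm hm)⟩)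
    (fun m hm => ⟨m.1, Prod.ext rfl (Eq.symm hm)⟩)

/-- A Čech cochain `p` is the gluing datum of an extension of `𝒪(n)` by `F`; a retraction of this
extension exhibits `p` as a coboundary. -/
lemma twistsAcyclic_of_rightPerp (h : rightPerp (twists k) F) : TwistsAcyclic F := by
  -- Multiplication by a power of `x` moves the twist from the summand of `N` to that of `M`,
  -- exchanging `n` and `-n`.
  suffices H : ∀ (n : ℤ) (p : F.P), ∃ (m : F.M) (y : F.N),
      p = (T n : k[T;T⁻¹]) • F.s m + F.t y by
    intro n p
    obtain ⟨m, y, hp⟩ := H (-n) ((T (-n) : k[T;T⁻¹]) • p)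
    refine ⟨m, y, ?_⟩
    have := congrArg (fun z => (T n : k[T;T⁻¹]) • z) hp
    simpa only [T_smul_T_smul, smul_add, add_neg_cancel, T_zero_smul] using this
  intro n p
  obtain ⟨r, hr⟩ := (h (twist k n) ⟨n⟩).exists_retraction (extension_shortExact F n p)
  have hrM : ∀ m, r.hM.hom ((m, 0) : F.M × k[X]) = m := fun m => congr($(congrArg Hom.hM hr).hom m)
  have hrP : ∀ m, r.hP.hom ((m, 0) : F.P × k[T;T⁻¹]) = m := fun m =>
    congr($(congrArg Hom.hP hr).hom m)
  have h1 : r.hP.hom ((0, 1) : F.P × k[T;T⁻¹]) = F.s (r.hM.hom ((0, 1) : F.M × k[X])) := by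
    have := hP_s r ((0, 1) : F.M × k[X])
    rw [← this]
    congr 1
    exact Prod.ext (map_zero F.s).symm (map_one (inclPos k)).symm
  have h2 : r.hP.hom ((p, T n) : F.P × k[T;T⁻¹]) = F.t (r.hN.hom ((0, 1) : F.N × k[X])) := by
    have := hP_t r ((0, 1) : F.N × k[X])
    rw [← this]
    congr 1
    refine Prod.ext ?_ ?_
    · change p = F.t 0 + inclNeg k 1 • p
      rw [map_zero, map_one, one_smul, zero_add]
    · change T n = T n * inclNeg k 1
      rw [map_one, mul_one]
  -- The generators over the two charts are `(0, 1)` and `(p, x ^ n)` over the intersection, so the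
  -- second minus `x ^ n` times the first is exactly `p`.
  have h3 : ((p, T n) : F.P × k[T;T⁻¹]) = (p, 0) + (T n : k[T;T⁻¹]) • ((0, 1) : F.P × k[T;T⁻¹]) := by
    refine Prod.ext ?_ ?_
    · change p = p + (T n : k[T;T⁻¹]) • (0 : F.P)
      rw [smul_zero, add_zero]
    · change T n = 0 + T n * (1 : k[T;T⁻¹])
      rw [zero_add, mul_one]
  have h4 : r.hP.hom ((p, T n) : F.P × k[T;T⁻¹]) =
      p + (T n : k[T;T⁻¹]) • r.hP.hom ((0, 1) : F.P × k[T;T⁻¹]) := by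
    conv_lhs => rw [h3]
    exact (r.hP.hom.map_add _ _).trans (congrArg₂ _ (hrP p) (r.hP.hom.map_smul _ _))
  refine ⟨-r.hM.hom ((0, 1) : F.M × k[X]), r.hN.hom ((0, 1) : F.N × k[X]), ?_⟩
  rw [← h2, h4, h1, map_neg, smul_neg, add_comm, add_neg_cancel_right]

/-- The two generators of `𝒪(n)` lift to `L` separately. Their mismatch over the intersection lies
in `F`, and writing it as a coboundary corrects the lifts so that they glue. -/
lemma rightPerp_of_twistsAcyclic (h : TwistsAcyclic F) : rightPerp (twists k) F := by
  rintro _ ⟨n⟩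
  refine ExtOneVanishes.of_section fun L i p w hL => ?_
  obtain ⟨p1, _, p3⟩ := surj_of_shortExact hL
  obtain ⟨_, e2, _⟩ := exact_of_shortExact hL
  obtain ⟨m, hm⟩ := p1 (genM n)
  obtain ⟨y, hy⟩ := p3 (genN n)
  have hm : p.hM.hom m = genM n := hm
  have hy : p.hN.hom y = genN n := hy
  obtain ⟨q, hq⟩ := (e2 (L.t y - (T n : k[T;T⁻¹]) • L.s m)).1 (by
    change p.hP.hom _ = 0
    rw [map_sub, map_smul, hP_s, hP_t, hm, hy, t_genN, sub_self])
  have hq : i.hP.hom q = L.t y - (T n : k[T;T⁻¹]) • L.s m := hq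
  obtain ⟨m', y', h'⟩ := h (-n) ((T (-n) : k[T;T⁻¹]) • q)
  have h'' : q = (T n : k[T;T⁻¹]) • F.s m' + F.t y' := by
    have := congrArg (fun z => (T n : k[T;T⁻¹]) • z) h'
    simpa only [T_smul_T_smul, smul_add, add_neg_cancel, T_zero_smul] using this
  refine ⟨ofSections n (m + i.hM.hom m') (y - i.hN.hom y') ?_, ?_⟩
  · rw [map_sub, map_add, ← hP_s, ← hP_t, smul_add, sub_eq_iff_eq_add, add_assoc,
      ← map_smul i.hP.hom, ← map_add i.hP.hom, ← h'', hq, add_sub_cancel]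
  · have z1 : p.hM.hom (i.hM.hom m') = 0 := congr($(congrArg Hom.hM w).hom m')
    have z3 : p.hN.hom (i.hN.hom y') = 0 := congr($(congrArg Hom.hN w).hom y')
    apply twist_hom_ext
    · change p.hM.hom ((ofSections n _ _ _).hM.hom (genM n)) = genM n
      rw [ofSections_hM, map_add, z1, hm, add_zero]
    · change p.hN.hom ((ofSections n _ _ _).hN.hom (genN n)) = genN n
      rw [ofSections_hN, map_sub, z3, hy, sub_zero]

lemma rightPerp_twists_iff : rightPerp (twists k) F ↔ TwistsAcyclic F :=
  ⟨twistsAcyclic_of_rightPerp, rightPerp_of_twistsAcyclic⟩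

end QcoP1

end

end LocallyProjective

namespace LocallyProjective

noncomputable section

variable {k : Type u} [Field k]

/-! ### Gluing direct sums of copies of a sheaf -/

section FinsuppLocalization

variable {A B M P ι : Type*} [CommRing A] [CommRing B] [AddCommGroup M] [AddCommGroup P]
  [Module A M] [Module B P] {φ : A →+* B}

lemma mapRange_smul_of_semilinear (f : M →+ P) (hf : ∀ (a : A) (m : M), f (a • m) = φ a • f m)
    (a : A) (m : ι →₀ M) : Finsupp.mapRange.addMonoidHom (ι := ι) f (a • m) =
      φ a • Finsupp.mapRange.addMonoidHom (ι := ι) f m := by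
  ext i
  simp [hf]

/-- Finitely supported families have a common denominator; this makes `glue` satisfy the
localization conditions. -/
lemma exists_pow_smul_eq_mapRange (f : M →+ P) (hf : ∀ (a : A) (m : M), f (a • m) = φ a • f m)
    (a : A) (h : ∀ p : P, ∃ (n : ℕ) (m : M), φ a ^ n • p = f m) (p : ι →₀ P) :
    ∃ (n : ℕ) (m : ι →₀ M), φ a ^ n • p = Finsupp.mapRange.addMonoidHom f m := by
  induction p using Finsupp.induction_linear with
  | zero => exact ⟨0, 0, by simp⟩
  | add p q hp hq =>
    obtain ⟨n, m, h1⟩ := hp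
    obtain ⟨n', m', h2⟩ := hq
    refine ⟨n + n', a ^ n' • m + a ^ n • m', ?_⟩
    rw [map_add, mapRange_smul_of_semilinear f hf, mapRange_smul_of_semilinear f hf, ← h1, ← h2,
      map_pow, map_pow, smul_smul, smul_smul, smul_add, pow_add, mul_comm (φ a ^ n')]
  | single i p =>
    obtain ⟨n, m, h1⟩ := h p
    exact ⟨n, Finsupp.single i m, by simp [h1]⟩

lemma exists_pow_smul_eq_zero_of_mapRange (f : M →+ P) (a : A)
    (h : ∀ m : M, f m = 0 → ∃ n : ℕ, a ^ n • m = 0) (m : ι →₀ M)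
    (hm : Finsupp.mapRange.addMonoidHom f m = 0) : ∃ n : ℕ, a ^ n • m = 0 := by
  have h0 : ∀ i, f (m i) = 0 := fun i => by simpa using DFunLike.congr_fun hm i
  choose n hn using fun i => h (m i) (h0 i)
  refine ⟨m.support.sup n, ?_⟩
  ext i
  by_cases hi : i ∈ m.support
  · obtain ⟨c, hc⟩ := Nat.exists_eq_add_of_le (Finset.le_sup (f := n) hi)
    rw [Finsupp.smul_apply, hc, add_comm, pow_add, mul_smul, hn, smul_zero, Finsupp.zero_apply]
  · rw [Finsupp.smul_apply, Finsupp.notMem_support_iff.1 hi, smul_zero, Finsupp.zero_apply]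

end FinsuppLocalization

namespace QcoP1

open LaurentPolynomial

variable {F G H : QcoP1 k}

/-- The direct sum of copies of `V` over `Spec k[x]` and over `Spec k[x⁻¹]`, glued by an
automorphism `A` over `Spec k[x, x⁻¹]`. -/
def glue (V : QcoP1 k) (ι : Type u) (A : (ι →₀ V.P) ≃ₗ[k[T;T⁻¹]] (ι →₀ V.P)) : QcoP1 k :=
  mk' (ModuleCat.of _ (ι →₀ V.M)) (ModuleCat.of _ (ι →₀ V.P)) (ModuleCat.of _ (ι →₀ V.N))
    (Finsupp.mapRange.addMonoidHom V.s)
    (A.toLinearMap.toAddMonoidHom.comp (Finsupp.mapRange.addMonoidHom V.t))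
    (fun a m => mapRange_smul_of_semilinear V.s V.s_smul a m)
    (fun a m => (congrArg A (mapRange_smul_of_semilinear V.t V.t_smul a m)).trans (A.map_smul _ _))
    (fun p => exists_pow_smul_eq_mapRange V.s V.s_smul Polynomial.X V.s_surj p)
    (fun m h => exists_pow_smul_eq_zero_of_mapRange V.s _ V.s_inj m h)
    (fun p => by
      obtain ⟨n, m, h⟩ := exists_pow_smul_eq_mapRange V.t V.t_smul Polynomial.X V.t_surj (A.symm p)
      refine ⟨n, m, ?_⟩
      change _ = A (Finsupp.mapRange.addMonoidHom V.t m)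
      rw [← h, map_smul, A.apply_symm_apply])
    (fun m h => exists_pow_smul_eq_zero_of_mapRange V.t _ V.t_inj m
      (A.injective (h.trans (map_zero A).symm)))

section Glue

variable {V : QcoP1 k} {ι : Type u} {A : (ι →₀ V.P) ≃ₗ[k[T;T⁻¹]] (ι →₀ V.P)}

lemma glue_s_single (i : ι) (m : V.M) :
    (glue V ι A).s (Finsupp.single i m : ι →₀ V.M) = (Finsupp.single i (V.s m) : ι →₀ V.P) :=
  Finsupp.mapRange_single (hf := map_zero V.s)

lemma glue_t_single (i : ι) (y : V.N) :
    (glue V ι A).t (Finsupp.single i y : ι →₀ V.N) = A (Finsupp.single i (V.t y)) :=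
  congrArg A (Finsupp.mapRange_single (hf := map_zero V.t))

lemma locallyProjective_glue (h : locallyProjective k V) : locallyProjective k (glue V ι A) := by
  have := free_M h
  have := free_N h
  exact locallyProjective_of_M_N (inferInstanceAs (Module.Projective k[X] (ι →₀ V.M)))
    (inferInstanceAs (Module.Projective k[X] (ι →₀ V.N)))

end Glue

/-! ### Covering a sheaf by a direct sum of twists -/

section Cover

/-- The automorphism of a free module which multiplies the coordinate `i` by `x ^ n i`. -/
def diagT (V : QcoP1 k) {ι : Type u} (n : ι → ℤ) : (ι →₀ V.P) ≃ₗ[k[T;T⁻¹]] (ι →₀ V.P) :=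
  LinearEquiv.ofLinearMap
    (Finsupp.lsum k[T;T⁻¹] fun i => (T (n i) : k[T;T⁻¹]) • Finsupp.lsingle i)
    (Finsupp.lsum k[T;T⁻¹] fun i => (T (-n i) : k[T;T⁻¹]) • Finsupp.lsingle i)
    (by
      ext i p : 2
      simp only [LinearMap.comp_apply, Finsupp.lsingle_apply, Finsupp.lsum_single,
        LinearMap.smul_apply, map_smul, T_smul_T_smul, neg_add_cancel, T_zero_smul,
        LinearMap.id_apply])
    (by
      ext i p : 2
      simp only [LinearMap.comp_apply, Finsupp.lsingle_apply, Finsupp.lsum_single,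
        LinearMap.smul_apply, map_smul, T_smul_T_smul, add_neg_cancel, T_zero_smul,
        LinearMap.id_apply])

lemma diagT_single (V : QcoP1 k) {ι : Type u} (n : ι → ℤ) (i : ι) (p : V.P) :
    diagT V n (Finsupp.single i p) = Finsupp.single i ((T (n i) : k[T;T⁻¹]) • p) := by
  simp [diagT]

/-- The direct sum of the sheaves `𝒪(n i)`. -/
def sumTwist (k : Type u) [Field k] {ι : Type u} (n : ι → ℤ) : QcoP1 k :=
  glue (twist k 0) ι (diagT _ n)

/-- The morphism from a direct sum of sheaves `𝒪(n i)` given by compatible sections. -/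
def sumTwistDesc {ι : Type u} (n : ι → ℤ) (m : ι → F.M) (y : ι → F.N)
    (h : ∀ i, F.t (y i) = (T (n i) : k[T;T⁻¹]) • F.s (m i)) : sumTwist k n ⟶ F :=
  homMk (F := sumTwist k n) (Finsupp.linearCombination k[X] m)
    (Finsupp.linearCombination k[T;T⁻¹] fun i => F.s (m i)) (Finsupp.linearCombination k[X] y)
    (DFunLike.congr_fun (show ((Finsupp.linearCombination k[T;T⁻¹]
        fun i => F.s (m i)).toAddMonoidHom.comp (sumTwist k n).s : (ι →₀ k[X]) →+ F.P) =
        F.s.comp (Finsupp.linearCombination k[X] m).toAddMonoidHom from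
      Finsupp.addHom_ext fun i q => by
        have e := glue_s_single (V := twist k 0) (A := diagT _ n) i q
        refine (congrArg (Finsupp.linearCombination k[T;T⁻¹] fun i => F.s (m i)) e).trans ?_
        refine (Finsupp.linearCombination_single _ _ _).trans ?_
        refine (s_smul q (m i)).symm.trans (congrArg F.s ?_)
        exact (Finsupp.linearCombination_single _ _ _).symm))
    (DFunLike.congr_fun (show ((Finsupp.linearCombination k[T;T⁻¹]
        fun i => F.s (m i)).toAddMonoidHom.comp (sumTwist k n).t : (ι →₀ k[X]) →+ F.P) =
        F.t.comp (Finsupp.linearCombination k[X] y).toAddMonoidHom from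
      Finsupp.addHom_ext fun i q => by
        have e := (glue_t_single (V := twist k 0) (A := diagT _ n) i q).trans (diagT_single _ n i _)
        refine (congrArg (Finsupp.linearCombination k[T;T⁻¹] fun i => F.s (m i)) e).trans ?_
        refine (Finsupp.linearCombination_single _ _ _).trans ?_
        refine Eq.trans ?_ ((t_smul q (y i)).symm.trans (congrArg F.t
          (Finsupp.linearCombination_single _ _ _).symm))
        rw [h, smul_smul]
        change (T (n i) * (T 0 * inclNeg k q) : k[T;T⁻¹]) • _ = _
        rw [T_zero, one_mul, mul_comm]))

/-- One summand is taken for each section over each chart, with the twist chosen so that the section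
is the image of its generator. -/
lemma exists_locallyProjective_epi (F : QcoP1 k) :
    ∃ (G : QcoP1 k) (p : G ⟶ F), locallyProjective k G ∧ Epi p := by
  choose n y hy using F.exists_compatible_of_M
  choose n' m' hm' using F.exists_compatible_of_N
  refine ⟨_, sumTwistDesc (ι := F.M ⊕ F.N) (Sum.elim n n') (Sum.elim id m') (Sum.elim y id)
    (Sum.rec hy hm'), locallyProjective_glue (locallyProjective_twist 0),
    epi_of_surjective_M_N _ (fun m => ?_) (fun z => ?_)⟩
  · exact ⟨(Finsupp.single (Sum.inl m) 1 : (F.M ⊕ F.N) →₀ k[X]),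
      (Finsupp.linearCombination_single _ _ _).trans (one_smul _ _)⟩
  · exact ⟨(Finsupp.single (Sum.inr z) 1 : (F.M ⊕ F.N) →₀ k[X]),
      (Finsupp.linearCombination_single _ _ _).trans (one_smul _ _)⟩

end Cover

/-- Finite words in the natural numbers. -/
inductive Word : Type u
  | nil : Word
  | cons (i : ℕ) (w : Word) : Word

/-! ### Embedding a sheaf into one whose twists have no first cohomology -/

section Hull

variable (V : QcoP1 k)

/-- The gluing matrix of the hull on basis elements. -/
def hullMatrix : Word.{u} → V.P →ₗ[k[T;T⁻¹]] (Word.{u} →₀ V.P)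
  | .nil => Finsupp.lsingle .nil
  -- The exponents are chosen so that, after twisting by `n`, the value `x ^ (-n-i) p` at `cons i w`
  -- becomes `p` at `w` plus `x ^ i p` at `cons i w`. For `i` large, the input is a section over
  -- `k[x⁻¹]` and the extra term is a section over `k[x]`.
  | .cons i w => (T (2 * i) : k[T;T⁻¹]) • Finsupp.lsingle (.cons i w) +
      (T i : k[T;T⁻¹]) • Finsupp.lsingle w

/-- The inverse of the gluing matrix of the hull on basis elements. -/
def hullMatrixInv : Word.{u} → V.P →ₗ[k[T;T⁻¹]] (Word.{u} →₀ V.P)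
  | .nil => Finsupp.lsingle .nil
  -- The matrix lowers word length only by stripping the first letter, so its inverse is found by
  -- recursion on the word.
  | .cons i w => (T (-(2 * i)) : k[T;T⁻¹]) • Finsupp.lsingle (.cons i w) -
      (T (-i) : k[T;T⁻¹]) • hullMatrixInv w

lemma hullMatrix_comp (w : Word.{u}) :
    (Finsupp.lsum k[T;T⁻¹] (hullMatrix V)).comp (hullMatrixInv V w) = Finsupp.lsingle w := by
  induction w with
  | nil => ext p : 1; simp [hullMatrix, hullMatrixInv]
  | cons i w ih =>
    rw [hullMatrixInv, LinearMap.comp_sub, LinearMap.comp_smul, LinearMap.comp_smul, ih]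
    ext p : 1
    simp only [LinearMap.sub_apply, LinearMap.smul_apply, LinearMap.comp_apply,
      Finsupp.lsingle_apply, Finsupp.lsum_single, hullMatrix, LinearMap.add_apply, smul_add,
      T_smul_T_smul, neg_add_cancel, T_zero_smul]
    rw [show -(2 * (i : ℤ)) + i = -i by ring, add_sub_cancel_right]

/-- The gluing automorphism of the hull. -/
def hullEquiv : (Word.{u} →₀ V.P) ≃ₗ[k[T;T⁻¹]] (Word.{u} →₀ V.P) :=
  LinearEquiv.ofLinearMap (Finsupp.lsum k[T;T⁻¹] (hullMatrix V))
    (Finsupp.lsum k[T;T⁻¹] (hullMatrixInv V))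
    (by
      ext w p : 2
      simpa using LinearMap.congr_fun (hullMatrix_comp V w) p)
    (by
      ext w p : 2
      cases w with
      | nil => simp [hullMatrix, hullMatrixInv]
      | cons i w =>
        simp only [LinearMap.comp_apply, Finsupp.lsingle_apply, Finsupp.lsum_single, hullMatrix,
          LinearMap.add_apply, LinearMap.smul_apply, map_add, map_smul, hullMatrixInv,
          LinearMap.sub_apply, smul_sub, T_smul_T_smul, add_neg_cancel, T_zero_smul,
          LinearMap.id_apply]
        rw [show 2 * (i : ℤ) + -i = i by ring, sub_add_cancel])

/-- A sheaf containing `V` as a locally split subsheaf, all twists of which have vanishing first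
cohomology. -/
def hull : QcoP1 k := glue V Word (hullEquiv V)

/-- The inclusion of `V` in its hull. -/
def hullι : V ⟶ hull V :=
  homMk (G := hull V) (Finsupp.lsingle Word.nil) (Finsupp.lsingle Word.nil)
    (Finsupp.lsingle Word.nil) (fun m => (glue_s_single _ m).symm)
    (fun y => by
      refine Eq.symm ((glue_t_single _ y).trans ?_)
      simp only [hullEquiv, LinearEquiv.coe_ofLinearMap, Finsupp.lsum_single, hullMatrix]
      rfl)

/-- The coordinate at the empty word is a retraction on each chart. The two retractions need not be
compatible, since the gluing sends `cons i nil` partly into that coordinate. -/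
lemma locallySplit_hullι : LocallySplit (hullι V) :=
  ⟨⟨Finsupp.lapply Word.nil, fun _ => Finsupp.single_eq_same⟩,
    ⟨Finsupp.lapply Word.nil, fun _ => Finsupp.single_eq_same⟩⟩

instance : Mono (hullι V) :=
  mono_of_injective _ (Finsupp.single_injective _) (Finsupp.single_injective _)
    (Finsupp.single_injective _)

/-- A class supported at `w` becomes a coboundary through a longer word `cons i w`. Letting `i`
range over all naturals handles every pole order and twist, and using all words treats the added
summands in the same way. -/
lemma twistsAcyclic_hull : TwistsAcyclic (hull V) := by
  rintro n (p : Word.{u} →₀ V.P)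
  induction p using Finsupp.induction_linear with
  | zero => exact ⟨0, 0, by rw [map_zero, map_zero, smul_zero, add_zero]; rfl⟩
  | add p q hp hq =>
    obtain ⟨m, y, h⟩ := hp
    obtain ⟨m', y', h'⟩ := hq
    refine ⟨m + m', y + y', ?_⟩
    rw [map_add, map_add, smul_add, add_add_add_comm]
    exact congrArg₂ _ h h'
  | single w p =>
    obtain ⟨N, hN⟩ := V.exists_T_smul_eq_s (-p)
    obtain ⟨N', hN'⟩ := V.exists_T_smul_eq_t p
    -- `i` is taken large enough that `-x ^ i p` extends over `k[x]` and `x ^ (-n-i) p` extends over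
    -- `k[x⁻¹]`.
    obtain ⟨i, h1, h2⟩ : ∃ i : ℕ, N ≤ i ∧ -n - i ≤ N' := ⟨(max N (-n - N')).toNat, by lia, by lia⟩
    obtain ⟨m, hm⟩ := hN _ h1
    obtain ⟨y, hy⟩ := hN' _ h2
    refine ⟨(Finsupp.single (Word.cons i w) m : Word.{u} →₀ V.M),
      (Finsupp.single (Word.cons i w) y : Word.{u} →₀ V.N), ?_⟩
    have e1 : (hull V).s (Finsupp.single (Word.cons i w) m : Word.{u} →₀ V.M) = _ :=
      glue_s_single _ m
    have e2 : (hull V).t (Finsupp.single (Word.cons i w) y : Word.{u} →₀ V.N) = _ :=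
      glue_t_single _ y
    rw [e1, e2, ← hm, ← hy]
    change Finsupp.single w p = Finsupp.single (Word.cons i w) ((T i : k[T;T⁻¹]) • -p) +
      (T n : k[T;T⁻¹]) • hullEquiv V (Finsupp.single (Word.cons i w) ((T (-n - i) : k[T;T⁻¹]) • p))
    simp only [hullEquiv, LinearEquiv.coe_ofLinearMap, Finsupp.lsum_single, hullMatrix,
      LinearMap.add_apply, LinearMap.smul_apply, Finsupp.lsingle_apply, smul_add,
      Finsupp.smul_single, T_smul_T_smul]
    rw [show n + (2 * (i : ℤ) + (-n - i)) = i by ring, show n + ((i : ℤ) + (-n - i)) = 0 by ring,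
      ← add_assoc, ← Finsupp.single_add, ← smul_add, neg_add_cancel, smul_zero,
      Finsupp.single_zero, zero_add, T_zero_smul]

end Hull

end QcoP1

end

end LocallyProjective

namespace LocallyProjective

noncomputable section

/-! ### Well-orders adapted to a finitary relation -/

section Order

/-- Any set with a finitary relation has a well-order each of whose initial segments is, up to
finitely many elements, closed under the relation. -/
lemma exists_wellOrder_closed {ι : Type*} (r : ι → Finset ι) :
    ∃ (_ : LinearOrder ι) (_ : WellFoundedLT ι), ∀ i : ι, ∃ S : Set ι, (∀ j ∈ S, j < i) ∧
      (∀ j ∈ S, ∀ l ∈ r j, l ∈ S) ∧ {j | j < i ∧ j ∉ S}.Finite := by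
  obtain ⟨_, _⟩ := exists_wellFoundedLT ι
  let f : Set ι → Set ι := fun S => ⋃ y ∈ S, (r y : Set ι)
  -- The closure of a point under `r` is countable because each step adds finitely many elements;
  -- each closure is then enumerated by naturals.
  let reach : ι → Set ι := fun x => ⋃ n : ℕ, f^[n] {x}
  have hself : ∀ x, x ∈ reach x := fun x => Set.mem_iUnion.2 ⟨0, rfl⟩
  have hclosed : ∀ x, ∀ j ∈ reach x, ∀ l ∈ r j, l ∈ reach x := by
    intro x j hj l hl
    obtain ⟨n, hn⟩ := Set.mem_iUnion.1 hj
    refine Set.mem_iUnion.2 ⟨n + 1, ?_⟩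
    rw [Function.iterate_succ_apply']
    exact Set.mem_biUnion hn hl
  have hcount : ∀ x, (reach x).Countable := by
    refine fun x => Set.countable_iUnion fun n => ?_
    induction n with
    | zero => exact Set.countable_singleton x
    | succ n ih =>
      rw [Function.iterate_succ_apply']
      exact ih.biUnion fun y _ => (r y).countable_toSet
  choose e he using fun x => Set.countable_iff_exists_injOn.1 (hcount x)
  let block : ι → ι := fun y => wellFounded_lt.min {x | y ∈ reach x} ⟨y, hself y⟩
  have hblock : ∀ y, y ∈ reach (block y) := fun y =>
    wellFounded_lt.min_mem {x | y ∈ reach x} ⟨y, hself y⟩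
  have hblock_le : ∀ x y, y ∈ reach x → block y ≤ x := fun x y h =>
    not_lt.1 (wellFounded_lt.not_lt_min {x | y ∈ reach x} h)
  -- `block y` is the least point from which `y` is reachable. Ordering by block and then by
  -- enumeration leaves only finitely many predecessors in the same block.
  let κ : ι → ι ×ₗ ℕ := fun y => toLex (block y, e (block y) y)
  have hκ : Function.Injective κ := by
    intro y y' h
    have h1 : block y = block y' := congrArg (fun z => (ofLex z).1) h
    have h2 : e (block y) y = e (block y') y' := congrArg (fun z => (ofLex z).2) h
    rw [← h1] at h2
    exact he (block y) (hblock y) (by rw [h1]; exact hblock y') h2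
  have key : ∀ i : ι, ∃ S : Set ι, (∀ j ∈ S, κ j < κ i) ∧
      (∀ j ∈ S, ∀ l ∈ r j, l ∈ S) ∧ {j | κ j < κ i ∧ j ∉ S}.Finite := by
    intro i
    -- The earlier blocks form a closed set: anything reachable from `j` is reachable from `block
    -- j`, so its block is no larger.
    refine ⟨{j | block j < block i}, fun j hj => Prod.Lex.toLex_lt_toLex.2 (Or.inl hj),
      fun j hj l hl => lt_of_le_of_lt (hblock_le _ _ (hclosed _ _ (hblock j) l hl)) hj, ?_⟩
    have hsub : ∀ j ∈ {j | κ j < κ i ∧ j ∉ {j | block j < block i}},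
        block j = block i ∧ e (block i) j < e (block i) i := by
      rintro j ⟨h1, h2⟩
      rcases Prod.Lex.toLex_lt_toLex.1 h1 with h | ⟨h, h'⟩
      · exact absurd h h2
      · have h : block j = block i := h
        have h' : e (block j) j < e (block i) i := h'
        exact ⟨h, by rwa [h] at h'⟩
    refine Set.Finite.of_finite_image (f := e (block i))
      ((Set.finite_Iio (e (block i) i)).subset ?_) ?_
    · rintro _ ⟨j, hj, rfl⟩
      exact (hsub j hj).2
    · intro j hj j' hj' h
      refine he (block i) ?_ ?_ h
      · rw [← (hsub j hj).1]; exact hblock j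
      · rw [← (hsub j' hj').1]; exact hblock j'
  exact ⟨LinearOrder.lift' κ hκ, ⟨InvImage.wf κ wellFounded_lt⟩, key⟩

end Order

variable {k : Type u} [Field k]

open LaurentPolynomial QcoP1

/-! ### Comparison of two bases over `k[x, x⁻¹]` -/

section Lattice

lemma inclNeg_T_mul {d d' : ℤ} (h : d ≤ d') :
    ∃ q : k[X], (T d : k[T;T⁻¹]) = T d' * inclNeg k q := by
  refine ⟨Polynomial.X ^ (d' - d).toNat, ?_⟩
  rw [map_pow, inclNeg_X_pow, ← T_add]
  congr 1; lia

lemma exists_eq_T_mul_inclNeg (p : k[T;T⁻¹]) :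
    ∃ d : ℤ, ∀ d', d ≤ d' → ∃ q : k[X], p = T d' * inclNeg k q := by
  obtain ⟨N, q, hq⟩ := LaurentPolynomial.exists_T_pow (LaurentPolynomial.invert p)
  have hp : p = T N * inclNeg k q := by
    change p = T N * LaurentPolynomial.invert (Polynomial.toLaurent q)
    rw [hq, map_mul, LaurentPolynomial.invert_T, LaurentPolynomial.involutive_invert,
      mul_comm, mul_assoc, ← T_add, neg_add_cancel, T_zero, mul_one]
  refine ⟨N, fun d' h => ?_⟩
  obtain ⟨q', hq'⟩ := inclNeg_T_mul (k := k) h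
  exact ⟨q' * q, by rw [hp, hq', map_mul, mul_assoc]⟩

lemma exists_eq_T_mul_inclNeg_finset {α : Type*} (s : Finset α) (p : α → k[T;T⁻¹]) :
    ∃ d : ℤ, ∀ d', d ≤ d' → ∀ i ∈ s, ∃ q : k[X], p i = T d' * inclNeg k q := by
  classical
  induction s using Finset.induction_on with
  | empty => exact ⟨0, by simp⟩
  | insert a s _ ih =>
    obtain ⟨d, hd⟩ := ih
    obtain ⟨d1, hd1⟩ := exists_eq_T_mul_inclNeg (p a)
    refine ⟨max d d1, fun d' h i hi => ?_⟩
    rcases Finset.mem_insert.1 hi with rfl | hi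
    · exact hd1 d' (le_trans (le_max_right _ _) h)
    · exact hd d' (le_trans (le_max_left _ _) h) i hi

variable {ι ι' Q : Type*} [AddCommGroup Q] [Module k[T;T⁻¹] Q]

/-- The `k[x⁻¹]`-lattice spanned by a basis over `k[x, x⁻¹]`. -/
def negLattice (c : Module.Basis ι' k[T;T⁻¹] Q) : AddSubgroup Q where
  carrier := {z | ∀ j, ∃ q : k[X], c.repr z j = inclNeg k q}
  zero_mem' := fun j => ⟨0, by simp⟩
  add_mem' := fun {z w} hz hw j => by
    obtain ⟨q, hq⟩ := hz j
    obtain ⟨q', hq'⟩ := hw j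
    exact ⟨q + q', by rw [map_add, Finsupp.add_apply, hq, hq', map_add]⟩
  neg_mem' := fun {z} hz j => by
    obtain ⟨q, hq⟩ := hz j
    exact ⟨-q, by rw [map_neg, Finsupp.neg_apply, hq, map_neg]⟩

lemma smul_mem_negLattice (c : Module.Basis ι' k[T;T⁻¹] Q) (q : k[X]) {z : Q}
    (hz : z ∈ negLattice c) : inclNeg k q • z ∈ negLattice c := fun j => by
  obtain ⟨q', hq'⟩ := hz j
  exact ⟨q * q', by rw [map_smul, Finsupp.smul_apply, hq', smul_eq_mul, map_mul]⟩

lemma basis_mem_negLattice (c : Module.Basis ι' k[T;T⁻¹] Q) (j : ι') : c j ∈ negLattice c :=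
  fun l => by
    classical
    rw [c.repr_self, Finsupp.single_apply]
    split_ifs
    · exact ⟨1, (map_one _).symm⟩
    · exact ⟨0, (map_zero _).symm⟩

lemma exists_T_smul_mem_negLattice (c : Module.Basis ι' k[T;T⁻¹] Q) (z : Q) :
    ∃ N : ℤ, ∀ n, n ≤ N → (T n : k[T;T⁻¹]) • z ∈ negLattice c := by
  obtain ⟨d, hd⟩ := exists_eq_T_mul_inclNeg_finset (c.repr z).support (c.repr z)
  refine ⟨-d, fun n hn j => ?_⟩
  by_cases hj : j ∈ (c.repr z).support
  · obtain ⟨q, hq⟩ := hd (-n) (by lia) j hj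
    exact ⟨q, by rw [map_smul, Finsupp.smul_apply, smul_eq_mul, hq, ← mul_assoc, ← T_add,
      add_neg_cancel, T_zero, one_mul]⟩
  · exact ⟨0, by rw [map_smul, Finsupp.smul_apply, Finsupp.notMem_support_iff.1 hj, smul_zero,
      map_zero]⟩

/-- If the initial segment below `i` is closed up to finitely many elements, then the `i`-th
coordinates of the elements of the lattice with leading index at most `i` have bounded degree. -/
lemma exists_leading_bound [LinearOrder ι] (b : Module.Basis ι k[T;T⁻¹] Q)
    (c : Module.Basis ι' k[T;T⁻¹] Q) (i : ι) (S : Set ι) (hS : ∀ j ∈ S, j < i)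
    (hS' : ∀ j ∈ S, ∀ l ∈ (c.repr (b j)).support, ∀ j' ∈ (b.repr (c l)).support, j' ∈ S)
    (hfin : {j | j < i ∧ j ∉ S}.Finite) :
    ∃ d : ℤ, ∀ d', d ≤ d' → ∀ z ∈ negLattice c, (∀ j, i < j → b.repr z j = 0) →
      ∃ q : k[X], b.repr z i = T d' * inclNeg k q := by
  classical
  -- These finitely many `c l` are the only ones that can contribute to the coordinate at `i`: any
  -- other would come from some `b j` with `j ∈ S`, and closure of `S` would put `i` itself in `S`.
  let F : Finset ι' := (insert i hfin.toFinset).biUnion fun j => (c.repr (b j)).support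
  obtain ⟨d, hd⟩ := exists_eq_T_mul_inclNeg_finset F fun l => b.repr (c l) i
  refine ⟨d, fun d' hd' z hz hzi => ?_⟩
  choose q hq using hd d' hd'
  choose q' hq' using hz
  have hsupp : ∀ l ∉ F, c.repr z l * b.repr (c l) i = 0 := by
    intro l hl
    by_contra hne
    have h1 : c.repr z l ≠ 0 := left_ne_zero_of_mul hne
    have h2 : b.repr (c l) i ≠ 0 := right_ne_zero_of_mul hne
    have e : c.repr z l = (b.repr z).sum fun j a => a * c.repr (b j) l := by
      conv_lhs => rw [← b.linearCombination_repr z]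
      rw [Finsupp.linearCombination_apply, Finsupp.sum, map_sum, Finsupp.finsetSum_apply]
      simp [Finsupp.sum]
    rw [e] at h1
    obtain ⟨j, hj, hj'⟩ := Finset.exists_ne_zero_of_sum_ne_zero h1
    have hl' : l ∈ (c.repr (b j)).support := Finsupp.mem_support_iff.2 (right_ne_zero_of_mul hj')
    by_cases hjS : j ∈ S
    · exact lt_irrefl _ (hS _ (hS' j hjS l hl' i (Finsupp.mem_support_iff.2 h2)))
    · refine hl (Finset.mem_biUnion.2 ⟨j, ?_, hl'⟩)
      rcases lt_trichotomy j i with h | h | h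
      · exact Finset.mem_insert_of_mem (hfin.mem_toFinset.2 ⟨h, hjS⟩)
      · rw [h]; exact Finset.mem_insert_self _ _
      · exact absurd (hzi j h) (Finsupp.mem_support_iff.1 hj)
  have e : b.repr z i = ∑ l ∈ F, c.repr z l * b.repr (c l) i := by
    conv_lhs => rw [← c.linearCombination_repr z]
    rw [Finsupp.linearCombination_apply, Finsupp.sum, map_sum, Finsupp.finsetSum_apply]
    have : ∀ s : Finset ι', F ⊆ s → ∑ l ∈ F, c.repr z l * b.repr (c l) i =
        ∑ l ∈ s, c.repr z l * b.repr (c l) i := fun s hs =>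
      Finset.sum_subset hs fun l _ hl => hsupp l hl
    rw [this _ (Finset.subset_union_left (s₂ := (c.repr z).support))]
    rw [← Finset.sum_subset (Finset.subset_union_right (s₁ := F))]
    · simp
    · intro l _ hl
      rw [Finsupp.notMem_support_iff.1 hl, zero_mul]
  refine ⟨∑ l ∈ F.attach, q' l.1 * q l.1 l.2, ?_⟩
  rw [e, map_sum, Finset.mul_sum, ← Finset.sum_attach]
  refine Finset.sum_congr rfl fun l _ => ?_
  rw [hq', hq _ l.2, map_mul, mul_left_comm]

/-- Under the same hypothesis, there is an element of the lattice with leading coordinate a power of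
`x` at `i` which generates all the leading coordinates at `i`. -/
lemma exists_leading_generator [LinearOrder ι] (b : Module.Basis ι k[T;T⁻¹] Q)
    (c : Module.Basis ι' k[T;T⁻¹] Q) (i : ι) (S : Set ι) (hS : ∀ j ∈ S, j < i)
    (hS' : ∀ j ∈ S, ∀ l ∈ (c.repr (b j)).support, ∀ j' ∈ (b.repr (c l)).support, j' ∈ S)
    (hfin : {j | j < i ∧ j ∉ S}.Finite) :
    ∃ (e : ℤ) (z : Q), z ∈ negLattice c ∧ (∀ j, i < j → b.repr z j = 0) ∧ b.repr z i = T e ∧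
      ∀ v ∈ negLattice c, (∀ j, i < j → b.repr v j = 0) →
        ∃ q : k[X], b.repr v i = inclNeg k q * T e := by
  obtain ⟨d, hd⟩ := exists_leading_bound b c i S hS hS' hfin
  replace hd := hd d le_rfl
  let I : Ideal k[X] :=
    { carrier := {q | ∃ z ∈ negLattice c, (∀ j, i < j → b.repr z j = 0) ∧
        b.repr z i = T d * inclNeg k q}
      zero_mem' := ⟨0, zero_mem _, by simp, by simp⟩
      add_mem' := by
        rintro q q' ⟨z, h1, h2, h3⟩ ⟨z', h1', h2', h3'⟩
        exact ⟨z + z', add_mem h1 h1', fun j hj => by simp [h2 j hj, h2' j hj], by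
          simp [h3, h3', mul_add]⟩
      smul_mem' := by
        rintro a q ⟨z, h1, h2, h3⟩
        exact ⟨inclNeg k a • z, smul_mem_negLattice c a h1, fun j hj => by simp [h2 j hj], by
          rw [map_smul, Finsupp.smul_apply, h3, smul_eq_mul, smul_eq_mul, map_mul,
            mul_left_comm]⟩ }
  -- A sufficiently negative power of `x` times `b i` lies in the lattice, so the ideal contains a
  -- power of the prime `X`. Its generator is then associated to a power of `X`, which makes the
  -- leading coordinate a unit `T e`.
  have hpow : ∃ n : ℕ, Polynomial.X ^ n ∈ I := by
    obtain ⟨N, hN⟩ := exists_T_smul_mem_negLattice c (b i)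
    refine ⟨(d - N).toNat, (T (d - (d - N).toNat) : k[T;T⁻¹]) • b i, hN _ (by lia),
      fun j hj => ?_, ?_⟩
    · simp [hj.ne]
    · rw [map_pow, inclNeg_X_pow, ← T_add]
      simp [sub_eq_add_neg]
  obtain ⟨n, hn⟩ := hpow
  have hdvd := (Submodule.IsPrincipal.mem_iff_generator_dvd I).1 hn
  obtain ⟨m, _, hm⟩ := (dvd_prime_pow Polynomial.prime_X n).1 hdvd
  have hmI : Polynomial.X ^ m ∈ I :=
    (Submodule.IsPrincipal.mem_iff_generator_dvd I).2 hm.dvd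
  obtain ⟨z, h1, h2, h3⟩ := hmI
  have e0 : (T d * inclNeg k (Polynomial.X ^ m) : k[T;T⁻¹]) = T (d - m) := by
    rw [map_pow, inclNeg_X_pow, ← T_add, sub_eq_add_neg]
  refine ⟨d - m, z, h1, h2, by rw [h3, e0], fun v hv hvi => ?_⟩
  obtain ⟨q, hq⟩ := hd v hv hvi
  have hqI : q ∈ I := ⟨v, hv, hvi, hq⟩
  obtain ⟨a, ha⟩ := hm.symm.dvd.trans ((Submodule.IsPrincipal.mem_iff_generator_dvd I).1 hqI)
  exact ⟨a, by rw [hq, ha, map_mul, ← mul_assoc, e0, mul_comm]⟩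

/-- Let `Q` be a module with two bases `b` and `c` over `k[x, x⁻¹]`. If a module `H` satisfies
`H = M' + x ^ n • N'` for all `n`, then any prescription on `c` can be met modulo `N'` by a linear
map sending `b` into `M'`. -/
theorem exists_linearMap_of_bases {H : Type*} [AddCommGroup H] [Module k[T;T⁻¹] H]
    (b : Module.Basis ι k[T;T⁻¹] Q) (c : Module.Basis ι' k[T;T⁻¹] Q) (M' N' : AddSubgroup H)
    (hN' : ∀ (q : k[X]), ∀ y ∈ N', inclNeg k q • y ∈ N')
    (hH : ∀ (n : ℤ) (p : H), ∃ m ∈ M', ∃ y ∈ N', p = m + (T n : k[T;T⁻¹]) • y) (δ : ι' → H) :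
    ∃ φ : Q →ₗ[k[T;T⁻¹]] H, (∀ i, φ (b i) ∈ M') ∧ ∀ j, φ (c j) - δ j ∈ N' := by
  obtain ⟨r, hr⟩ : ∃ r : ι → Finset ι, ∀ j, ∀ l ∈ (c.repr (b j)).support,
      ∀ j' ∈ (b.repr (c l)).support, j' ∈ r j := by
    classical
    exact ⟨fun j => (c.repr (b j)).support.biUnion fun l => (b.repr (c l)).support,
      fun j l hl j' hj' => Finset.mem_biUnion.2 ⟨l, hl, hj'⟩⟩
  obtain ⟨_, _, hord⟩ := exists_wellOrder_closed r
  have hgen : ∀ i, ∃ (e : ℤ) (z : Q), z ∈ negLattice c ∧ (∀ j, i < j → b.repr z j = 0) ∧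
      b.repr z i = T e ∧ ∀ v ∈ negLattice c, (∀ j, i < j → b.repr v j = 0) →
        ∃ q : k[X], b.repr v i = inclNeg k q * T e := by
    intro i
    obtain ⟨S, h1, h2, h3⟩ := hord i
    exact exists_leading_generator b c i S h1
      (fun j hj l hl j' hj' => h2 j hj j' (hr j l hl j' hj')) h3
  choose e z hz hzi hze hzgen using hgen
  -- This is the rank one case: the hypothesis on `H` with twist `-e i`, rescaled by `x ^ e i`.
  have hpick : ∀ (i : ι) (p : H), ∃ m ∈ M', (T (e i) : k[T;T⁻¹]) • m - p ∈ N' := by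
    intro i p
    obtain ⟨m, hm, y, hy, h⟩ := hH (-e i) ((T (-e i) : k[T;T⁻¹]) • p)
    refine ⟨m, hm, ?_⟩
    have h' := congrArg (fun z => (T (e i) : k[T;T⁻¹]) • z) h
    simp only [T_smul_T_smul, smul_add, add_neg_cancel, T_zero_smul] at h'
    rw [h', sub_add_cancel_left]
    exact neg_mem hy
  choose pick hpickM hpickN using hpick
  let δ' : Q →ₗ[k[T;T⁻¹]] H := c.constr ℕ δ
  -- The value at `b i` is chosen in `M'` after all smaller ones, so that `φ` agrees with `δ'` on `z
  -- i` modulo `N'`; the sum is the contribution of the coordinates of `z i` below `i`, already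
  -- determined.
  let h : ι → H := wellFounded_lt.fix fun i h => pick i (δ' (z i) -
    ∑ j ∈ (b.repr (z i)).support, if hj : j < i then b.repr (z i) j • h j hj else 0)
  have hh : ∀ i, h i = pick i (δ' (z i) -
      ∑ j ∈ (b.repr (z i)).support, if j < i then b.repr (z i) j • h j else 0) := by
    intro i
    exact wellFounded_lt.fix_eq _ i
  let φ : Q →ₗ[k[T;T⁻¹]] H := b.constr ℕ h
  have hφb : ∀ i, φ (b i) = h i := fun i => b.constr_basis ℕ h i
  have hφz : ∀ i, φ (z i) = (T (e i) : k[T;T⁻¹]) • h i +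
      ∑ j ∈ (b.repr (z i)).support, if j < i then b.repr (z i) j • h j else 0 := by
    intro i
    have e1 : φ (z i) = ∑ j ∈ (b.repr (z i)).support, b.repr (z i) j • h j := by
      rw [Module.Basis.constr_apply, Finsupp.sum]
    have e2 : (T (e i) : k[T;T⁻¹]) • h i = ∑ j ∈ (b.repr (z i)).support,
        if j = i then b.repr (z i) j • h j else 0 := by
      rw [Finset.sum_ite_eq', ← hze]
      split_ifs with hi
      · rfl
      · rw [Finsupp.notMem_support_iff.1 hi, zero_smul]
    rw [e1, e2, ← Finset.sum_add_distrib]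
    refine Finset.sum_congr rfl fun j _ => ?_
    rcases lt_trichotomy j i with hj | hj | hj
    · rw [if_neg hj.ne, if_pos hj, zero_add]
    · rw [if_pos hj, if_neg hj.not_lt, add_zero]
    · rw [if_neg hj.ne', if_neg hj.not_gt, hzi i j hj, zero_smul, add_zero]
  have hzN : ∀ i, φ (z i) - δ' (z i) ∈ N' := by
    intro i
    rw [hφz, hh, add_sub_assoc, ← neg_sub (δ' (z i)), ← sub_eq_add_neg]
    exact hpickN _ _
  -- The `z i` generate the lattice over `k[x⁻¹]` by elimination of leading terms, so agreement
  -- modulo `N'` passes to all of it, in particular to every `c j`.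
  have hle : negLattice c ≤ N'.comap (φ - δ').toAddMonoidHom := by
    refine addSubgroup_le_of_triangular b _ _ fun i v hv hvi => ?_
    obtain ⟨q, hq⟩ := hzgen i v hv hvi
    refine ⟨inclNeg k q • z i, ?_, sub_mem hv (smul_mem_negLattice c q (hz i)), fun j hj => ?_⟩
    · change (φ - δ') (inclNeg k q • z i) ∈ N'
      rw [map_smul]
      exact hN' q _ (hzN i)
    · rcases hj.eq_or_lt with rfl | hj
      · simp [hq, hze]
      · simp [hvi j hj, hzi i j hj]
  refine ⟨φ, fun i => by rw [hφb, hh]; exact hpickM _ _, fun j => ?_⟩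
  have := hle (basis_mem_negLattice c j)
  have e3 : δ' (c j) = δ j := c.constr_basis ℕ δ j
  rw [← e3]
  exact this

end Lattice

end

end LocallyProjective

namespace LocallyProjective

noncomputable section

variable {k : Type u} [Field k]

open LaurentPolynomial

/-! ### Extensions of locally projective sheaves by sheaves in `𝒰^⊥` -/

namespace QcoP1

variable {F G : QcoP1 k}

/-- A morphism between sheaves is determined by values on bases over the affine charts which are
compatible over the intersection. -/
lemma exists_hom_of_bases {ι ι' : Type*} (b : Module.Basis ι k[X] F.M)
    (c : Module.Basis ι' k[X] F.N) (μ : ι → G.M) (ν : ι' → G.N)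
    (ψ : F.P →ₗ[k[T;T⁻¹]] G.P) (h1 : ∀ i, ψ (F.s (b i)) = G.s (μ i))
    (h2 : ∀ j, ψ (F.t (c j)) = G.t (ν j)) :
    ∃ f : F ⟶ G, (∀ i, f.hM.hom (b i) = μ i) ∧ ∀ j, f.hN.hom (c j) = ν j := by
  refine ⟨homMk (b.constr ℕ μ) ψ (c.constr ℕ ν) (fun m => ?_) (fun m => ?_),
    fun i => b.constr_basis ℕ μ i, fun j => c.constr_basis ℕ ν j⟩
  · rw [← b.linearCombination_repr m, Finsupp.linearCombination_apply, Finsupp.sum]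
    simp only [map_sum, s_smul, map_smul, h1, b.constr_basis]
  · rw [← c.linearCombination_repr m, Finsupp.linearCombination_apply, Finsupp.sum]
    simp only [map_sum, t_smul, map_smul, h2, c.constr_basis]

/-- Locally projective sheaves have no extensions by sheaves all twists of which have vanishing
first cohomology. -/
theorem extOneVanishes_of_locallyProjective (hF : locallyProjective k F) (hG : TwistsAcyclic G) :
    ExtOneVanishes F G := by
  refine ExtOneVanishes.of_section fun L i p w hL => ?_
  have := free_M hF
  have := free_N hF
  let b := Module.Free.chooseBasis k[X] F.M
  let c := Module.Free.chooseBasis k[X] F.N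
  obtain ⟨b', hb'⟩ := F.exists_basis_P_of_M b
  obtain ⟨c', hc'⟩ := F.exists_basis_P_of_N c
  obtain ⟨p1, _, p3⟩ := surj_of_shortExact hL
  obtain ⟨_, e2, _⟩ := exact_of_shortExact hL
  choose μ hμ using fun j => p1 (b j)
  choose ν hν using fun j => p3 (c j)
  have hμ : ∀ j, p.hM.hom (μ j) = b j := hμ
  have hν : ∀ j, p.hN.hom (ν j) = c j := hν
  have e2 : ∀ q : L.P, p.hP.hom q = 0 → ∃ q', i.hP.hom q' = q := fun q => (e2 q).1
  -- The lifts over `k[x]` fix a section over the intersection. Its failure to match the lifts over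
  -- `k[x⁻¹]` is the cocycle `δ` with values in `G.P`.
  let ψ : F.P →ₗ[k[T;T⁻¹]] L.P := b'.constr ℕ fun j => L.s (μ j)
  have hψ : ∀ j, ψ (F.s (b j)) = L.s (μ j) := fun j => by
    rw [← hb']; exact b'.constr_basis ℕ _ j
  have hpψ : ∀ q, p.hP.hom (ψ q) = q := by
    have : p.hP.hom.comp ψ = LinearMap.id := b'.ext fun j => by
      rw [LinearMap.comp_apply, hb', hψ, hP_s, hμ, LinearMap.id_apply]
    exact fun q => LinearMap.congr_fun this q
  choose δ hδ using fun j => e2 (L.t (ν j) - ψ (F.t (c j))) (by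
    rw [map_sub, hpψ, hP_t, hν, sub_self])
  -- Adding `φ` changes the lifts of `b` by sections of `G` over `k[x]` and leaves on `c` a
  -- discrepancy that comes from sections of `G` over `k[x⁻¹]`; both are absorbed into the lifts.
  obtain ⟨φ, h1, h2⟩ := exists_linearMap_of_bases b' c' G.s.range G.t.range
    (by
      rintro q _ ⟨y, rfl⟩
      exact ⟨q • y, G.t_smul q y⟩)
    (fun n q => by
      obtain ⟨m, y, h⟩ := hG n q
      exact ⟨_, ⟨m, rfl⟩, _, ⟨y, rfl⟩, h⟩) δ
  choose α hα using h1
  choose γ hγ using h2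
  obtain ⟨f, hf1, hf2⟩ := exists_hom_of_bases (G := L) b c (fun j => μ j + i.hM.hom (α j))
    (fun j => ν j + i.hN.hom (γ j)) (ψ + i.hP.hom.comp φ)
    (fun j => by
      rw [LinearMap.add_apply, LinearMap.comp_apply, hψ, ← hb', ← hα, hP_s, map_add])
    (fun j => by
      rw [LinearMap.add_apply, LinearMap.comp_apply, map_add, ← hP_t i, hγ, map_sub, hδ, ← hc']
      abel)
  refine ⟨f, ?_⟩
  have z1 : ∀ m, p.hM.hom (i.hM.hom m) = 0 := fun m => congr($(congrArg Hom.hM w).hom m)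
  have z3 : ∀ m, p.hN.hom (i.hN.hom m) = 0 := fun m => congr($(congrArg Hom.hN w).hom m)
  have hM : ∀ m, (f ≫ p).hM.hom m = m := by
    have : (f ≫ p).hM.hom = LinearMap.id := b.ext fun j => by
      change p.hM.hom (f.hM.hom (b j)) = b j
      rw [hf1, map_add, z1, hμ, add_zero]
    exact fun m => LinearMap.congr_fun this m
  have hN : ∀ m, (f ≫ p).hN.hom m = m := by
    have : (f ≫ p).hN.hom = LinearMap.id := c.ext fun j => by
      change p.hN.hom (f.hN.hom (c j)) = c j
      rw [hf2, map_add, z3, hν, add_zero]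
    exact fun m => LinearMap.congr_fun this m
  have hP : (f ≫ p).hP.hom = LinearMap.id := b'.ext fun j => by
    rw [hb', hP_s, hM]
    rfl
  ext m
  · exact hM m
  · exact LinearMap.congr_fun hP m
  · exact hN m

end QcoP1

end

end LocallyProjective

namespace LocallyProjective
noncomputable section

/-! ### Null-homotopies, mapping cones and contractible complexes -/

section Complexes

open CochainComplex CochainComplex.HomComplex

variable {A : Type*} [Category* A] [Abelian A]

/-- If `Ext¹(K⟦1⟧, L) = 0`, then every morphism `K ⟶ L` of complexes is null-homotopic. -/
lemma ExtOneVanishes.nonempty_homotopy {K L : CochainComplex A ℤ}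
    (H : ExtOneVanishes (K⟦(1 : ℤ)⟧) L) (φ : K ⟶ L) : Nonempty (Homotopy φ 0) := by
  -- A retraction of `L ⟶ cone φ` restricts along `inl` to a null-homotopy of `φ`.
  have hS : (mappingCone.triangleRotateShortComplex φ).ShortExact :=
    HomologicalComplex.shortExact_of_degreewise_shortExact _ fun n =>
      (mappingCone.triangleRotateShortComplexSplitting φ n).shortExact
  obtain ⟨r, hr⟩ : ∃ r : mappingCone φ ⟶ L, mappingCone.inr φ ≫ r = 𝟙 L :=
    H.exists_retraction hS
  refine ⟨(Cochain.equivHomotopy _ _).symm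
    ⟨(mappingCone.inl φ).comp (Cochain.ofHom r) (add_zero _), ?_⟩⟩
  rw [δ_comp_ofHom, mappingCone.δ_inl, ← Cochain.ofHom_comp, Category.assoc, hr,
    Category.comp_id, Cochain.ofHom_zero, add_zero]

/-- If `Ext¹(M⟦1⟧, E⟦n⟧) = 0` for all `n`, then the complex `Hom(M, E)` is exact. -/
lemma homComplex_acyclic {M E : CochainComplex A ℤ}
    (H : ∀ n : ℤ, ExtOneVanishes (M⟦(1 : ℤ)⟧) (E⟦n⟧)) : (HomComplex M E).Acyclic := by
  intro n
  rw [HomologicalComplex.exactAt_iff_isZero_homology]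
  -- Degree `n` cohomology classes are homotopy classes of morphisms `M ⟶ E⟦n⟧`.
  have : Subsingleton (CohomologyClass M E n) := by
    refine ⟨fun a b => ?_⟩
    suffices h : ∀ c : CohomologyClass M E n, c = 0 by rw [h a, h b]
    intro c
    obtain ⟨x, rfl⟩ := c.mk_surjective
    rw [CohomologyClass.mk_eq_zero_iff, ← CohomologyClass.toHom_mk_eq_zero_iff,
      CohomologyClass.toHom_mk, HomotopyCategory.quotient_map_eq_zero_iff]
    exact (H n).nonempty_homotopy _
  have : Subsingleton ((HomComplex M E).homology n) := (homologyAddEquiv M E n).injective.subsingleton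
  exact AddCommGrpCat.isZero_of_subsingleton _

/-- The cone of the identity is acyclic. -/
lemma acyclic_mappingCone_id (W : CochainComplex A ℤ) : (mappingCone (𝟙 W)).Acyclic := by
  intro n
  rw [HomologicalComplex.exactAt_iff_isZero_homology, IsZero.iff_id_eq_zero,
    ← HomologicalComplex.homologyMap_id,
    (mappingCone.homotopyToZeroOfId W).homologyMap_eq, HomologicalComplex.homologyMap_zero]

/-- The complex with given terms and zero differential. -/
def zeroDiff (W : ℤ → A) : CochainComplex A ℤ where
  X := W
  d _ _ := 0

@[simp] lemma zeroDiff_d (W : ℤ → A) (p q : ℤ) : (zeroDiff W).d p q = 0 := rfl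

/-- The morphism from the contractible complex on `W` induced by morphisms `W n ⟶ Z.X (n - 1)`. -/
def coneDesc {W : ℤ → A} {Z : CochainComplex A ℤ} (a : ∀ p q : ℤ, p + (-1) = q → ((zeroDiff W).X p ⟶ Z.X q)) :
    mappingCone (𝟙 (zeroDiff W)) ⟶ Z :=
  mappingCone.desc _ (Cochain.mk fun p q h => a p q h)
    { f := fun n => a n (n - 1) rfl ≫ Z.d (n - 1) n
      comm' := fun i j hij => by simp }
    (by
      ext p
      rw [δ_v (-1) 0 (by norm_num) _ p p (add_zero p) (p - 1) (p + 1) rfl rfl]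
      simp)

lemma inl_coneDesc {W : ℤ → A} {Z : CochainComplex A ℤ}
    (a : ∀ p q : ℤ, p + (-1) = q → ((zeroDiff W).X p ⟶ Z.X q)) (p q : ℤ) (h : p + (-1) = q) :
    (mappingCone.inl (𝟙 (zeroDiff W))).v p q h ≫ (coneDesc a).f q = a p q h := by
  simp [coneDesc]

/-- The morphism to the contractible complex on `W` induced by morphisms `Z.X n ⟶ W n`. -/
def coneLift {W : ℤ → A} {Z : CochainComplex A ℤ} (b : ∀ n : ℤ, Z.X n ⟶ (zeroDiff W).X n) :
    Z ⟶ mappingCone (𝟙 (zeroDiff W)) :=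
  mappingCone.lift _ (Cocycle.mk (Cochain.mk fun p q _ => Z.d p q ≫ b q) 2 rfl (by
      ext p q h
      rw [δ_v 1 2 (by norm_num) _ p q h (p + 1) (p + 1) (by lia) rfl]
      simp))
    (Cochain.ofHoms b)
    (by
      ext p q h
      obtain rfl := h
      rw [Cochain.add_v, δ_v 0 1 (by norm_num) _ p (p + 1) rfl p (p + 1) (by lia) rfl]
      simp)

lemma coneLift_snd {W : ℤ → A} {Z : CochainComplex A ℤ} (b : ∀ n : ℤ, Z.X n ⟶ (zeroDiff W).X n) (n : ℤ) :
    (coneLift b).f n ≫ (mappingCone.snd (𝟙 (zeroDiff W))).v n n (add_zero n) = b n := by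
  simp [coneLift]

end Complexes
end
end LocallyProjective

namespace LocallyProjective
noncomputable section

/-! ### Cycles, boundaries and exactness -/

section Cycles

variable {A : Type*} [Category* A] [Abelian A]

lemma shortExact_of_exists_lift {K B C : A} (i : K ⟶ B) (p : B ⟶ C) (w : i ≫ p = 0) [Mono i]
    [Epi p] (h : ∀ (T : A) (g : T ⟶ B), g ≫ p = 0 → ∃ g' : T ⟶ K, g' ≫ i = g) :
    (ShortComplex.mk i p w).ShortExact :=
  ⟨ShortComplex.exact_of_f_is_kernel _ (KernelFork.IsLimit.ofι' i w fun g hg =>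
    ⟨(h _ g hg).choose, (h _ g hg).choose_spec⟩)⟩

lemma shortExact_of_eval {K L M : CochainComplex A ℤ} (i : K ⟶ L) (p : L ⟶ M) (w : i ≫ p = 0)
    (h : ∀ n, (ShortComplex.mk (i.f n) (p.f n) congr($(w).f n)).ShortExact) :
    (ShortComplex.mk i p w).ShortExact :=
  HomologicalComplex.shortExact_of_degreewise_shortExact _ h

lemma shortExact_eval {K L M : CochainComplex A ℤ} {i : K ⟶ L} {p : L ⟶ M} {w : i ≫ p = 0}
    (h : (ShortComplex.mk i p w).ShortExact) (n : ℤ) :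
    (ShortComplex.mk (i.f n) (p.f n) congr($(w).f n)).ShortExact :=
  (HomologicalComplex.shortExact_iff_degreewise_shortExact _).1 h n

lemma epi_toCycles {E : CochainComplex A ℤ} (hE : E.Acyclic) (n : ℤ) :
    Epi (E.toCycles n (n + 1)) := by
  have h := hE (n + 1)
  rw [E.exactAt_iff' n (n + 1) (n + 1 + 1) (by simp) (by simp)] at h
  have := h.epi_toCycles
  rw [← E.toCycles_cyclesIsoSc'_hom n (n + 1) (n + 1 + 1) (by simp) (by simp)] at this
  exact (epi_comp_iff_of_isIso _ _).1 this

lemma shortExact_cycles {E : CochainComplex A ℤ} (hE : E.Acyclic) (n : ℤ) :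
    (ShortComplex.mk (E.iCycles n) (E.toCycles n (n + 1)) (by
      rw [← cancel_mono (E.iCycles (n + 1)), Category.assoc, E.toCycles_i, E.iCycles_d,
        zero_comp])).ShortExact :=
  have := epi_toCycles hE n
  shortExact_of_exists_lift _ _ _ fun _ g hg => ⟨E.liftCycles g (n + 1) (by simp) (by
    rw [← E.toCycles_i n (n + 1), reassoc_of% hg, zero_comp]), by simp⟩

/-- The inclusion of the cycles, as a complex with zero differential. -/
def cyclesι (M : CochainComplex A ℤ) : zeroDiff (fun n => M.cycles n) ⟶ M where
  f n := M.iCycles n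
  comm' i j _ := (M.iCycles_d i j).trans zero_comp.symm

/-- The projection to the boundaries, as a complex with zero differential. -/
def boundariesπ (M : CochainComplex A ℤ) : M ⟶ zeroDiff (fun n => image (M.d n (n + 1))) where
  f n := factorThruImage (M.d n (n + 1))
  comm' i j hij := by
    obtain rfl : i + 1 = j := hij
    have h : M.d i (i + 1) ≫ factorThruImage (M.d (i + 1) (i + 1 + 1)) = 0 := by
      rw [← cancel_mono (image.ι _), Category.assoc, image.fac, M.d_comp_d, zero_comp]
    exact comp_zero.trans h.symm

lemma iCycles_factorThruImage (M : CochainComplex A ℤ) (n : ℤ) :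
    M.iCycles n ≫ factorThruImage (M.d n (n + 1)) = 0 := by
  rw [← cancel_mono (image.ι _), Category.assoc, image.fac, M.iCycles_d, zero_comp]

lemma shortExact_cycles_boundaries (M : CochainComplex A ℤ) :
    (ShortComplex.mk (cyclesι M) (boundariesπ M)
      (by ext n; exact iCycles_factorThruImage M n)).ShortExact :=
  shortExact_of_eval _ _ _ fun n =>
    shortExact_of_exists_lift (M.iCycles n) (factorThruImage (M.d n (n + 1)))
      (iCycles_factorThruImage M n) fun _ g hg =>
        ⟨M.liftCycles g (n + 1) (by simp) (by
          rw [← image.fac (M.d n (n + 1)), reassoc_of% hg, zero_comp]), M.liftCycles_i _ _ _ _⟩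

end Cycles

/-! ### Extensions of complexes with locally projective terms -/

variable (k : Type u) [Field k]

/-- The complexes with locally projective terms. -/
def termwiseLocallyProjective : ObjectProperty (CochainComplex (QcoP1 k) ℤ) := fun M =>
  ∀ n : ℤ, locallyProjective k (M.X n)

variable {k}

open QcoP1

/-- In an exact complex each term is an extension of cycles by cycles, and each cycle object is a
quotient of the preceding term. The class `𝒰^⊥` is stable under both. -/
lemma exactWithCyclesInPerp_iff {E : CochainComplex (QcoP1 k) ℤ} :
    exactWithCyclesInPerp k E ↔ E.Acyclic ∧ ∀ n, TwistsAcyclic (E.X n) := by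
  refine ⟨fun ⟨h, h'⟩ => ⟨h, fun n => ?_⟩, fun ⟨h, h'⟩ => ⟨h, fun n => ?_⟩⟩
  · exact .of_shortExact (shortExact_cycles h n) (rightPerp_twists_iff.1 (h' _))
      (rightPerp_twists_iff.1 (h' _))
  · obtain ⟨n, rfl⟩ : ∃ m, m + 1 = n := ⟨n - 1, by lia⟩
    have := epi_toCycles h n
    exact rightPerp_twists_iff.2 ((h' n).of_epi (E.toCycles n (n + 1)))

lemma exists_comp_d_eq {E : CochainComplex (QcoP1 k) ℤ} (hE : exactWithCyclesInPerp k E)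
    {F : QcoP1 k} (hF : locallyProjective k F) (n : ℤ) (e : F ⟶ E.X (n + 1))
    (he : e ≫ E.d (n + 1) (n + 1 + 1) = 0) : ∃ h : F ⟶ E.X n, h ≫ E.d n (n + 1) = e := by
  obtain ⟨h, hh⟩ := (extOneVanishes_of_locallyProjective hF
    (rightPerp_twists_iff.1 (hE.2 n))).exists_lift (shortExact_cycles hE.1 n)
    (E.liftCycles e (n + 1 + 1) (by simp) he)
  exact ⟨h, by rw [← E.toCycles_i n (n + 1), reassoc_of% hh, E.liftCycles_i]⟩

/-- With zero differential on `W`, a family of sections is a chain map as soon as each one is killed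
by the differential of `L`, so every degree can be treated independently. -/
lemma extOneVanishes_zeroDiff {W : ℤ → QcoP1 k} (hW : ∀ n, locallyProjective k (W n))
    {E : CochainComplex (QcoP1 k) ℤ} (hE : exactWithCyclesInPerp k E) :
    ExtOneVanishes (zeroDiff W) E := by
  refine .of_section fun L i p w h => ?_
  have hn := shortExact_eval h
  have (n : ℤ) : Mono (i.f n) := (hn n).mono_f
  have key (n : ℤ) : ∃ s : W n ⟶ L.X n, s ≫ p.f n = 𝟙 _ ∧ s ≫ L.d n (n + 1) = 0 := by
    obtain ⟨s, hs⟩ := (extOneVanishes_of_locallyProjective (hW n)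
      ((exactWithCyclesInPerp_iff.1 hE).2 n)).exists_section (hn n)
    obtain ⟨e, he⟩ : ∃ e : W n ⟶ E.X (n + 1), e ≫ i.f (n + 1) = s ≫ L.d n (n + 1) :=
      ⟨(hn (n + 1)).exact.lift (s ≫ L.d n (n + 1)) (by
        change (s ≫ L.d n (n + 1)) ≫ p.f (n + 1) = 0
        rw [Category.assoc, ← p.comm, zeroDiff_d, comp_zero, comp_zero]),
        (hn (n + 1)).exact.lift_f _ _⟩
    -- The defect of `s` is a cycle of `E` in degree `n + 1`; it lifts through the differential of
    -- `E`, and subtracting the lift keeps `s` a section.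
    obtain ⟨g, hg⟩ := exists_comp_d_eq hE (hW n) n e (by
      rw [← cancel_mono (i.f _), Category.assoc, ← i.comm, reassoc_of% he, L.d_comp_d, comp_zero,
        zero_comp])
    refine ⟨s - g ≫ i.f n, ?_, ?_⟩
    · have w' : i.f n ≫ p.f n = 0 := congr($(w).f n)
      rw [Preadditive.sub_comp, Category.assoc, w', comp_zero, sub_zero]
      exact hs
    · rw [Preadditive.sub_comp, Category.assoc, i.comm, reassoc_of% hg, he, sub_self]
  choose s hs hs' using key
  refine ⟨{ f := s, comm' := fun i j hij => ?_ }, ?_⟩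
  · obtain rfl : i + 1 = j := hij
    exact (hs' i).trans zero_comp.symm
  · ext n : 1
    exact hs n

/-- Complexes with locally projective terms have no nontrivial extensions by exact complexes with
cycles in `𝒰^⊥`. -/
theorem extOneVanishes_of_termwiseLocallyProjective {M E : CochainComplex (QcoP1 k) ℤ}
    (hM : termwiseLocallyProjective k M) (hE : exactWithCyclesInPerp k E) : ExtOneVanishes M E :=
  .of_shortExact_left (shortExact_cycles_boundaries M)
    (extOneVanishes_zeroDiff (fun n => locallyProjective_of_mono (M.iCycles n) (hM n)) hE)
    (extOneVanishes_zeroDiff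
      (fun n => locallyProjective_of_mono (image.ι (M.d n (n + 1))) (hM (n + 1))) hE)

lemma exactWithCyclesInPerp_shift {E : CochainComplex (QcoP1 k) ℤ}
    (hE : exactWithCyclesInPerp k E) (n : ℤ) : exactWithCyclesInPerp k (E⟦n⟧) := by
  obtain ⟨h, h'⟩ := exactWithCyclesInPerp_iff.1 hE
  refine exactWithCyclesInPerp_iff.2 ⟨?_, fun i => h' _⟩
  -- Acyclic complexes form a shift-stable subcategory of the homotopy category, from which
  -- stability is read off.
  rw [← HomotopyCategory.quotient_obj_mem_subcategoryAcyclic_iff_acyclic] at h ⊢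
  exact (HomotopyCategory.subcategoryAcyclic (QcoP1 k)).prop_of_iso
    (((HomotopyCategory.quotient (QcoP1 k) (ComplexShape.up ℤ)).commShiftIso n).symm.app E)
    ((HomotopyCategory.subcategoryAcyclic (QcoP1 k)).le_shift n _ h)

/-- Both classes are stable under shifts, so the vanishing of `Ext¹` already gives exactness of
`Hom(M, E)`. -/
lemma dgLocallyProjective_eq : dgLocallyProjective k = termwiseLocallyProjective k := by
  ext M
  exact ⟨fun h => h.1, fun h => ⟨h, fun E hE => homComplex_acyclic fun n =>
    extOneVanishes_of_termwiseLocallyProjective (fun i => h _)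
      (exactWithCyclesInPerp_shift hE n)⟩⟩

end
end LocallyProjective

namespace LocallyProjective
noncomputable section

/-! ### Approximation sequences for complexes -/

open QcoP1 CochainComplex

variable {k : Type u} [Field k]

/-- The contractible complex on the family `W`. -/
abbrev disk (W : ℤ → QcoP1 k) : CochainComplex (QcoP1 k) ℤ := mappingCone (𝟙 (zeroDiff W))

lemma termwiseLocallyProjective_disk {W : ℤ → QcoP1 k} (hW : ∀ n, locallyProjective k (W n)) :
    termwiseLocallyProjective k (disk W) := fun n =>
  locallyProjective_of_decomp _ _ _ _ (mappingCone.id_X (𝟙 (zeroDiff W)) n (n + 1) rfl)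
    (hW (n + 1)) (hW n)

lemma exactWithCyclesInPerp_disk {W : ℤ → QcoP1 k} (hW : ∀ n, TwistsAcyclic (W n)) :
    exactWithCyclesInPerp k (disk W) :=
  exactWithCyclesInPerp_iff.2 ⟨acyclic_mappingCone_id _, fun n =>
    .of_decomp _ _ _ _ (mappingCone.id_X (𝟙 (zeroDiff W)) n (n + 1) rfl) (hW (n + 1)) (hW n)⟩

lemma exists_termwiseLocallyProjective_epi (Z : CochainComplex (QcoP1 k) ℤ) :
    ∃ (G : CochainComplex (QcoP1 k) ℤ) (p : G ⟶ Z), termwiseLocallyProjective k G ∧ Epi p := by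
  choose W a hW ha using fun n : ℤ => exists_locallyProjective_epi (Z.X (n + (-1)))
  -- `inl` has degree `-1`, so `W p` must cover the term of `Z` in degree `p - 1`.
  refine ⟨disk W, coneDesc fun p q h => a p ≫ eqToHom (by rw [h]),
    termwiseLocallyProjective_disk hW, ?_⟩
  refine HomologicalComplex.epi_of_epi_f _ fun n => ?_
  have e := inl_coneDesc (W := W) (fun p q h => a p ≫ eqToHom (by rw [h])) (n + 1) n (by lia)
  have : Epi (a (n + 1) ≫ eqToHom (by rw [add_neg_cancel_right]) : _ ⟶ Z.X n) := epi_comp _ _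
  exact @epi_of_epi_fac _ _ _ _ _ _ _ _ this e

/-- The embedding of a complex in a contractible complex on hulls. -/
def diskι (Z : CochainComplex (QcoP1 k) ℤ) : Z ⟶ disk fun n => hull (Z.X n) :=
  coneLift fun n => hullι (Z.X n)

lemma diskι_snd (Z : CochainComplex (QcoP1 k) ℤ) (n : ℤ) :
    (diskι Z).f n ≫ (mappingCone.snd (𝟙 (zeroDiff _))).v n n (add_zero n) = hullι (Z.X n) :=
  coneLift_snd _ n

instance (Z : CochainComplex (QcoP1 k) ℤ) : Mono (diskι Z) :=
  HomologicalComplex.mono_of_mono_f _ fun n => 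
    @mono_of_mono_fac _ _ _ _ _ _ _ _ (inferInstanceAs (Mono (hullι (Z.X n)))) (diskι_snd Z n)

lemma exactWithCyclesInPerp_diskι (Z : CochainComplex (QcoP1 k) ℤ) :
    exactWithCyclesInPerp k (disk fun n => hull (Z.X n)) :=
  exactWithCyclesInPerp_disk fun _ => twistsAcyclic_hull _

/-- In each degree the embedding followed by `snd` is the inclusion in the hull, which is split on
charts; hence the embedding itself is split on charts. -/
lemma termwiseLocallyProjective_cokernel_diskι {Z : CochainComplex (QcoP1 k) ℤ}
    (hZ : termwiseLocallyProjective k Z) : termwiseLocallyProjective k (cokernel (diskι Z)) :=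
  fun n => by
    refine LocallySplit.locallyProjective (shortExact_eval (shortExact_cokernel (diskι Z)) n) ?_
      (termwiseLocallyProjective_disk (fun n => locallyProjective_glue (hZ n)) n)
    refine LocallySplit.of_comp (g := (mappingCone.snd (𝟙 (zeroDiff _))).v n n (add_zero n)) ?_
    have := locallySplit_hullι (Z.X n)
    rwa [← diskι_snd] at this

lemma termwiseLocallyProjective_of_mono {M N : CochainComplex (QcoP1 k) ℤ} (f : M ⟶ N) [Mono f]
    (hN : termwiseLocallyProjective k N) : termwiseLocallyProjective k M :=
  fun n => locallyProjective_of_mono (f.f n) (hN n)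

/-- The kernel `K` of a cover `G ⟶ Z` is embedded in a contractible complex `D` on hulls. The
pushout of `G` and `D` under `K` is an extension of `Z` by `D`, and also of `D/K` by `G`. -/
lemma hasEnoughProjectives :
    HasEnoughProjectives (termwiseLocallyProjective k) (exactWithCyclesInPerp k) := by
  intro Z
  obtain ⟨G, p, hG, _⟩ := exists_termwiseLocallyProjective_epi Z
  have hK := termwiseLocallyProjective_of_mono (kernel.ι p) hG
  refine ⟨_, _, _, _, _, ?_, exactWithCyclesInPerp_diskι _,
    shortExact_pushout (shortExact_kernel p) (diskι (kernel p))⟩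
  -- The second of these sequences shows that the pushout has locally projective terms.
  have h := shortExact_pushout (shortExact_cokernel (diskι (kernel p))) (kernel.ι p)
  refine termwiseLocallyProjective_of_mono (pushoutSymmetry _ _).hom fun n =>
    locallyProjective_of_extension (shortExact_eval h n) (hG n)
      (termwiseLocallyProjective_cokernel_diskι hK n)

lemma exactWithCyclesInPerp_of_extension {K L M : CochainComplex (QcoP1 k) ℤ} {i : K ⟶ L}
    {p : L ⟶ M} {w : i ≫ p = 0} (h : (ShortComplex.mk i p w).ShortExact)
    (hK : exactWithCyclesInPerp k K) (hM : exactWithCyclesInPerp k M) :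
    exactWithCyclesInPerp k L := by
  rw [exactWithCyclesInPerp_iff] at *
  exact ⟨h.acyclic_X₂ hK.1 hM.1, fun n => .of_shortExact (shortExact_eval h n) (hK.2 n) (hM.2 n)⟩

lemma exactWithCyclesInPerp_of_iso {K L : CochainComplex (QcoP1 k) ℤ} (e : K ≅ L)
    (hK : exactWithCyclesInPerp k K) : exactWithCyclesInPerp k L := by
  rw [exactWithCyclesInPerp_iff] at *
  exact ⟨fun n => (hK.1 n).of_iso e, fun n => (hK.2 n).of_epi (e.hom.f n)⟩

/-- Salce's argument: with `Z` embedded in `D` and `F ⟶ D/Z` a projective approximation with kernel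
`C`, the pullback of `D` and `F` over `D/Z` is an extension of `F` by `Z`, and also of `D` by `C`.
-/
lemma hasEnoughInjectives :
    HasEnoughInjectives (termwiseLocallyProjective k) (exactWithCyclesInPerp k) := by
  intro Z
  obtain ⟨C, F, i, p, w, hF, hC, h⟩ := hasEnoughProjectives (cokernel (diskι Z))
  refine ⟨_, _, _, _, _, hF, ?_, shortExact_pullback (shortExact_cokernel (diskι Z)) p⟩
  have h' := exactWithCyclesInPerp_of_extension (shortExact_pullback h (cokernel.π (diskι Z))) hC
    (exactWithCyclesInPerp_diskι Z)
  exact exactWithCyclesInPerp_of_iso (pullbackSymmetry _ _) h'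

/-- A complex in the left orthogonal splits off its projective approximation, and subobjects inherit
locally projective terms. -/
lemma leftPerp_exactWithCyclesInPerp :
    leftPerp (exactWithCyclesInPerp k) = termwiseLocallyProjective k := by
  ext M
  refine ⟨fun h => ?_, fun h E hE => extOneVanishes_of_termwiseLocallyProjective h hE⟩
  obtain ⟨C, F, i, p, w, hF, hC, hS⟩ := hasEnoughProjectives M
  obtain ⟨s, hs⟩ := (h C hC).exists_section hS
  have : Mono s := mono_of_mono_fac hs
  exact termwiseLocallyProjective_of_mono s hF

end
end LocallyProjective

namespace LocallyProjective
noncomputable section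

/-! ### Orthogonality to stalk complexes, and cogeneration -/

section Single

variable {A : Type*} [Category* A] [Abelian A]

lemma ExtOneVanishes.exists_comp_d_eq {X : A} {E : CochainComplex A ℤ} {n : ℤ}
    (H : ExtOneVanishes ((HomologicalComplex.single A (ComplexShape.up ℤ) n).obj X) E)
    (g : X ⟶ E.X (n + 1)) (hg : g ≫ E.d (n + 1) (n + 1 + 1) = 0) :
    ∃ f : X ⟶ E.X n, f ≫ E.d n (n + 1) = g := by
  -- The stalk of `X` in degree `n` is the shift of the stalk in degree `n + 1`. The morphism `g`
  -- out of the latter is therefore null-homotopic, and the homotopy is the required lift.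
  have H' : ExtOneVanishes (((HomologicalComplex.single A (ComplexShape.up ℤ) (n + 1)).obj X)⟦(1 : ℤ)⟧) E :=
    H.of_iso (((CochainComplex.singleFunctors A).shiftIso 1 n (n + 1) (by lia)).symm.app X)
      (Iso.refl _)
  obtain ⟨h⟩ := H'.nonempty_homotopy (HomologicalComplex.mkHomFromSingle g (by
    rintro j rfl; exact hg))
  have e := h.comm (n + 1)
  rw [dNext_eq _ (i' := n + 1 + 1) rfl, prevD_eq _ (j' := n) rfl, HomologicalComplex.single_obj_d,
    zero_comp, zero_add, HomologicalComplex.zero_f, add_zero,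
    HomologicalComplex.mkHomFromSingle_f] at e
  exact ⟨(HomologicalComplex.singleObjXSelf (.up ℤ) (n + 1) X).inv ≫ h.hom (n + 1) n, by
    rw [Category.assoc, ← e, Iso.inv_hom_id_assoc]⟩

/-- An extension of `X` by the cycles becomes an extension of stalks. Extending the inclusion of the
cycles into `E` to the middle stalk gives a morphism with values in cycles, which is a retraction.
-/
lemma ExtOneVanishes.of_single {X : A} {E : CochainComplex A ℤ} {n : ℤ}
    (H : ExtOneVanishes ((HomologicalComplex.single A (ComplexShape.up ℤ) n).obj X) E) :
    ExtOneVanishes X (E.cycles n) := by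
  refine .of_retraction fun L i p w h => ?_
  have h' := h.map_of_exact (HomologicalComplex.single A (ComplexShape.up ℤ) n)
  obtain ⟨g, hg⟩ := H.exists_extension h' (HomologicalComplex.mkHomFromSingle (E.iCycles n)
    fun j _ => E.iCycles_d n j)
  let φ := (HomologicalComplex.singleObjXSelf (.up ℤ) n L).inv ≫ g.f n
  have hφ : φ ≫ E.d n (n + 1) = 0 := by
    rw [Category.assoc, g.comm, HomologicalComplex.single_obj_d, zero_comp, comp_zero]
  refine ⟨E.liftCycles φ (n + 1) (by simp) hφ, ?_⟩
  rw [← cancel_mono (E.iCycles n), Category.assoc, E.liftCycles_i, Category.id_comp]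
  have e : ((HomologicalComplex.single A (ComplexShape.up ℤ) n).map i).f n ≫ g.f n = _ :=
    congr($(hg).f n)
  rw [HomologicalComplex.single_map_f_self, HomologicalComplex.mkHomFromSingle_f, Category.assoc,
    Category.assoc] at e
  exact (cancel_epi _).1 e

end Single

open QcoP1

variable {k : Type u} [Field k]

lemma termwiseLocallyProjective_stalkTwist (i : ℤ × ℤ) :
    termwiseLocallyProjective k (stalkTwist k i) := fun n => by
  by_cases h : n = -i.2
  · subst h
    let e : (stalkTwist k i).X (-i.2) ≅ twist k i.1 := HomologicalComplex.singleObjXSelf _ _ _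
    exact locallyProjective_of_mono e.hom (locallyProjective_twist _)
  · exact locallyProjective_of_isZero (HomologicalComplex.isZero_single_obj_X _ _ _ _ h)

/-- Morphisms from any `𝒪(n)` to the cycles lift through the differential, and the `𝒪(n)` detect
epimorphisms; hence `E` is exact. -/
lemma exactWithCyclesInPerp_of_rightPerp {E : CochainComplex (QcoP1 k) ℤ}
    (hE : rightPerp (ObjectProperty.ofObj (stalkTwist k)) E) : exactWithCyclesInPerp k E := by
  have H (n j : ℤ) : ExtOneVanishes ((HomologicalComplex.single (QcoP1 k) (ComplexShape.up ℤ) j).obj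
      (twist k n)) E := by
    have := hE _ (ObjectProperty.ofObj_apply (stalkTwist k) (n, -j))
    rwa [stalkTwist, neg_neg] at this
  refine ⟨fun j => ?_, fun j => ?_⟩
  · obtain ⟨j, rfl⟩ : ∃ m, m + 1 = j := ⟨j - 1, by lia⟩
    have : Epi (E.toCycles j (j + 1)) := epi_of_lift_twist _ fun n g => by
      obtain ⟨f, hf⟩ := (H n j).exists_comp_d_eq (g ≫ E.iCycles (j + 1)) (by
        rw [Category.assoc, E.iCycles_d, comp_zero])
      exact ⟨f, by rw [← cancel_mono (E.iCycles (j + 1)), Category.assoc, E.toCycles_i, hf]⟩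
    rw [HomologicalComplex.exactAt_iff_isZero_homology, IsZero.iff_id_eq_zero,
      ← cancel_epi (E.homologyπ (j + 1)), ← cancel_epi (E.toCycles j (j + 1))]
    simp
  · rintro _ ⟨n⟩
    exact (H n j).of_single

lemma rightPerp_stalkTwist :
    rightPerp (ObjectProperty.ofObj (stalkTwist k)) = exactWithCyclesInPerp k := by
  ext E
  refine ⟨exactWithCyclesInPerp_of_rightPerp, ?_⟩
  rintro hE _ ⟨i⟩
  exact extOneVanishes_of_termwiseLocallyProjective (termwiseLocallyProjective_stalkTwist i) hE

lemma rightPerp_termwiseLocallyProjective :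
    rightPerp (termwiseLocallyProjective k) = exactWithCyclesInPerp k := by
  ext E
  refine ⟨fun h => exactWithCyclesInPerp_of_rightPerp ?_,
    fun hE M hM => extOneVanishes_of_termwiseLocallyProjective hM hE⟩
  rintro _ ⟨i⟩
  exact h _ (termwiseLocallyProjective_stalkTwist i)

end

end LocallyProjective

theorem mainTheorem9 (k : Type u) [Field k] :
    LocallyProjective.IsCompleteCotorsionPair (LocallyProjective.dgLocallyProjective k)
        (LocallyProjective.exactWithCyclesInPerp k) ∧
      LocallyProjective.IsCogeneratedBy (LocallyProjective.dgLocallyProjective k)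
        (LocallyProjective.exactWithCyclesInPerp k) (LocallyProjective.stalkTwist k) := by
  rw [LocallyProjective.dgLocallyProjective_eq]
  refine ⟨⟨⟨LocallyProjective.rightPerp_termwiseLocallyProjective,
    LocallyProjective.leftPerp_exactWithCyclesInPerp⟩, LocallyProjective.hasEnoughInjectives,
    LocallyProjective.hasEnoughProjectives⟩, ?_, LocallyProjective.rightPerp_stalkTwist.symm⟩
  rw [LocallyProjective.rightPerp_stalkTwist, LocallyProjective.leftPerp_exactWithCyclesInPerp]
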